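/- Let $H$ be a real Hilbert space with identity operator $I$. For bounded self-adjoint operators $U,V$ on $H$ write $U\succeq V$ if $\langle Ux,x\rangle\ge\langle Vx,x\rangle$ for all $x\in H$, and for $\alpha>0$ let $\mathcal P_\alpha(H)$ be the set of bounded self-adjoint operators $U$ with $U\succeq\alpha I$. For $W\in\mathcal P_\alpha(H)$ put $\|x\|_W=\sqrt{\langle Wx,x\rangle}$. For a set-valued operator $M:H\to 2^H$ let $J_M=(I+M)^{-1}$ be its resolvent and $\operatorname{zer}M=\{x\in H: 0\in Mx\}$. Let $A:H\to 2^H$ be maximal monotone, and let $B:H\to H$ be $\beta$-cocoercive for some $\beta>0$, i.e. $\langle x-y,Bx-By\rangle\ge\beta\|Bx-By\|^2$ for all $x,y\in H$. Suppose that $\Omega:=\operatorname{zer}(A+B)\ne\emptyset$. Let $\alpha>0$, let $(\eta_k)_{k\ge0}$ be a summable sequence in $[0,+\infty)$, and let $(U_k)_{k\ge0}$ be a sequence in $\mathcal P_\alpha(H)$ such that $$\mu:=\sup_{k}\|U_k\|<+\infty\quad\text{and}\quad(1+\eta_k)U_{k+1}\succeq U_k\quad\text{for all }k\ge0.$$ Let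 $\gamma_k>0$ with $\gamma_k\|U_k\|<2\beta$, put $\alpha_k=\frac{2\beta}{4\beta-\gamma_k\|U_k\|}$, and let $0<\lambda_k<\frac1{\alpha_k}$. Let $(a_k)$ and $(b_k)$ be sequences in $H$ with $\sum_k\lambda_k\|a_k\|<+\infty$ and $\sum_k\lambda_k\|b_k\|<+\infty$. Let $x_0\in H$ and, for $k\ge0$, $$y_k=x_k-\gamma_kU_k(Bx_k+b_k),\qquad x_{k+1}=x_k+\lambda_k\bigl(J_{\gamma_kU_kA}(y_k)+a_k-x_k\bigr).$$ Then: (i) for every $x^*\in\Omega$, $\lim_{k\to\infty}\|x_k-x^*\|_{U_k^{-1}}$ exists. Suppose moreover that (a) $\sum_{k}\lambda_k\bigl(\frac1{\alpha_k}-\lambda_k\bigr)=+\infty$; (b) there are $\underline\gamma>0$ and $\epsilon\in(0,2\beta-\mu\underline\gamma)$ such that $\underline\gamma\le\gamma_k$ and $\gamma_k\mu\le 2\beta-\epsilon$ for all $k$; (c) $\sum_k|\gamma_{k+1}-\gamma_k|<+\infty$, $\sum_k\bigl|\gamma_{k+1}\|U_{k+1}\|-\gamma_k\|U_k\|\bigr|<+\infty$,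 and $\sum_k\|U_k^{-1}x-U_{k+1}^{-1}x\|<+\infty$ for every $x\in H$. Then: (ii) $\lim_{k\to\infty}\|x_k-J_{\gamma_kU_kA}(x_k-\gamma_kU_kBx_k)\|=0$; (iii) $(x_k)$ converges weakly to a point of $\Omega$; (iv) if in addition there is $\underline\lambda>0$ with $\lambda_k\ge\underline\lambda$ for all $k$, then $Bx_k\to Bx^*$ strongly for every $x^*\in\Omega$. -/

import Mathlib

open Filter Topology
open scoped InnerProductSpace

namespace VMFB

variable {H : Type*} [NormedAddCommGroup H] [InnerProductSpace ℝ H]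

/-- A set-valued operator `A : H → 2^H` is monotone. -/
def IsMonotoneOp (A : H → Set H) : Prop :=
  ∀ x y : H, ∀ u ∈ A x, ∀ v ∈ A y, 0 ≤ ⟪x - y, u - v⟫_ℝ

/-- `A` is maximal monotone: it is monotone and its graph is not strictly contained in the graph
of another monotone operator. -/
def IsMaximalMonotone (A : H → Set H) : Prop :=
  IsMonotoneOp A ∧ ∀ A' : H → Set H, IsMonotoneOp A' → (∀ x, A x ⊆ A' x) → A' = A

/-- `B : H → H` is `β`-cocoercive. -/
def IsCocoercive (β : ℝ) (B : H → H) : Prop :=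
  ∀ x y : H, β * ‖B x - B y‖ ^ 2 ≤ ⟪x - y, B x - B y⟫_ℝ

/-- The sum `A + B` of a set-valued operator and a single-valued operator. -/
def addSingle (A : H → Set H) (B : H → H) : H → Set H :=
  fun x => {w | ∃ u ∈ A x, w = u + B x}

/-- The set of zeros `zer M = {x | 0 ∈ M x}`. -/
def zer (M : H → Set H) : Set H := {x | (0 : H) ∈ M x}

/-- The set-valued operator `γ U A`, that is `x ↦ {γ • U u | u ∈ A x}`. -/
def scaledOp (γ : ℝ) (U : H →L[ℝ] H) (A : H → Set H) : H → Set H :=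
  fun x => {w | ∃ u ∈ A x, w = γ • U u}

/-- The set-valued inverse of `I + M`, evaluated at `y`: all `p` with `y ∈ p + M p`. -/
def invIdAdd (M : H → Set H) (y : H) : Set H := {p | ∃ w ∈ M p, y = p + w}

/-- The resolvent `J_M = (I + M)⁻¹` as a single-valued map: `J_M y` is the (for the operators
considered, existing and unique) element of `(I + M)⁻¹ y`. -/
noncomputable def resolvent (M : H → Set H) (y : H) : H :=
  Classical.epsilon fun p => p ∈ invIdAdd M y

/-- `𝒫_α(H)`: the bounded self-adjoint operators `U` with `U ⪰ α I`
(`≤` on `H →L[ℝ] H` is the Loewner order). -/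
def strongPos [CompleteSpace H] (α : ℝ) : Set (H →L[ℝ] H) :=
  {U | IsSelfAdjoint U ∧ α • (1 : H →L[ℝ] H) ≤ U}

/-- The norm `‖x‖_W = √⟨W x, x⟩`. -/
noncomputable def metricNorm (W : H →L[ℝ] H) (x : H) : ℝ := √⟪W x, x⟫_ℝ

/-- For `α > 0` every `U ∈ 𝒫_α(H)` is invertible, so `U.inverse` is its true inverse `U⁻¹`. -/
theorem inverse_of_mem_strongPos [CompleteSpace H] {α : ℝ} (hα : 0 < α) {U : H →L[ℝ] H}
    (hU : U ∈ strongPos α) : (∀ x, U (U.inverse x) = x) ∧ ∀ x, U.inverse (U x) = x := by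
  have hu : IsUnit U := by
    refine U.isUnit_of_forall_le_norm_inner_map (c := ⟨α, hα.le⟩) hα fun x => ?_
    have h := ((ContinuousLinearMap.le_def _ _).1 hU.2).2 x
    rw [ContinuousLinearMap.reApplyInnerSelf_apply] at h
    simp only [sub_apply, smul_apply,
      one_apply_eq_self, inner_sub_left, inner_smul_left, real_inner_self_eq_norm_sq,
      RCLike.re_to_real, conj_trivial] at h
    refine le_trans ?_ (Real.le_norm_self _)
    change ‖x‖ ^ 2 * α ≤ _
    linarith
  obtain ⟨u, rfl⟩ := hu
  let e := ContinuousLinearEquiv.unitsEquiv ℝ H u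
  have he : (u : H →L[ℝ] H) = (e : H →L[ℝ] H) := rfl
  rw [he, ContinuousLinearMap.inverse_equiv]
  exact ⟨fun x => e.apply_symm_apply x, fun x => e.symm_apply_apply x⟩

/-- The averagedness constant `2β / (4β - γ‖U‖)` of the forward-backward operator. -/
noncomputable def avgConst (β γ : ℝ) (U : H →L[ℝ] H) : ℝ := 2 * β / (4 * β - γ * ‖U‖)

/-- The forward-backward operator `x ↦ J_{γUA}(x - γ U B x)`. -/
noncomputable def fbOp (A : H → Set H) (B : H → H) (γ : ℝ) (U : H →L[ℝ] H) (x : H) : H :=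
  resolvent (scaledOp γ U A) (x - γ • U (B x))

end VMFB

/-!
Write `T` for the forward-backward operator `fbOp A B γ U` and `v = x - T x` for its residual.
The resolvent is everywhere defined because `A + c I` is onto (Minty's theorem, obtained by
minimising a quadratic energy over the epigraph of the Fitzpatrick function of `A`), and a
contraction argument passes from `c I` to `γ⁻¹ U⁻¹`.

For a zero `x*` of `A + B`, monotonicity of `A` and cocoercivity of `B` show that a relaxed step of
length `λ` decreases `‖x - x*‖²` in the metric `U⁻¹` by `λ` times a gap. The iteration is
therefore quasi-Fejér, which gives (i), and the gaps are summable with weights `λₖ`. Since the gap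
controls `‖v‖⁴`, also `∑ λₖ ‖vₖ‖⁴ < ∞`, so `‖vₖ‖` is small infinitely often.

Up to summable terms, `vₖ₊₁ - vₖ` is bounded by `λₖ ‖vₖ‖` and `‖(Uₖ⁻¹ - Uₖ₊₁⁻¹) vₖ‖`. Pointwise
summability of these operators makes the tails of their sums uniformly small on the unit ball, so
that they can be absorbed in the variation of `v`. As long as `‖vₖ‖ ≥ ρ`, the weights satisfy
`λₖ ‖vₖ‖ ≤ ρ⁻³ λₖ ‖vₖ‖⁴`, so late excursions above level `ρ` have height `O(ρ)`, and `vₖ → 0`.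
Consequently `B xₖ → B x*`, weak cluster points of `xₖ` are zeros of `A + B`, and the variable
metric version of Opial's lemma gives weak convergence.
-/

namespace VMFB

section ProxEnergy

variable {E : Type*} [NormedAddCommGroup E] [InnerProductSpace ℝ E]

/-- The height of a point of `E × ℝ` plus half its squared horizontal norm. Minimising it over the
epigraph of a convex function `f` amounts to evaluating the proximity operator of `f` at `0`. -/
noncomputable def proxEnergy (p : E × ℝ) : ℝ := p.2 + ‖p.1‖ ^ 2 / 2

theorem proxEnergy_convexComb (p r : E × ℝ) (s : ℝ) :
    proxEnergy ((1 - s) • p + s • r) =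
      (1 - s) * proxEnergy p + s * proxEnergy r - s * (1 - s) / 2 * ‖p.1 - r.1‖ ^ 2 := by
  simp only [proxEnergy, Prod.fst_add, Prod.snd_add, Prod.smul_fst, Prod.smul_snd, smul_eq_mul,
    norm_add_sq_real, norm_sub_sq_real, norm_smul, inner_smul_left, inner_smul_right, mul_pow,
    Real.norm_eq_abs, sq_abs, conj_trivial]
  ring

theorem sq_norm_sub_le_of_le_proxEnergy {C : Set (E × ℝ)} (hC : Convex ℝ C) {m : ℝ}
    (hm : ∀ p ∈ C, m ≤ proxEnergy p) {p r : E × ℝ} (hp : p ∈ C) (hr : r ∈ C) :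
    ‖p.1 - r.1‖ ^ 2 ≤ 4 * ((proxEnergy p - m) + (proxEnergy r - m)) := by
  have hmid := hm _ (hC hp hr (a := 1 - 1 / 2) (b := 1 / 2) (by norm_num) (by norm_num)
    (by norm_num))
  rw [proxEnergy_convexComb] at hmid
  linarith

theorem exists_isMinOn_proxEnergy [CompleteSpace E] {C : Set (E × ℝ)} (hC : Convex ℝ C)
    (hclosed : IsClosed C) (hne : C.Nonempty) (hbdd : BddBelow (proxEnergy '' C)) :
    ∃ p ∈ C, IsMinOn proxEnergy C p := by
  set m := sInf (proxEnergy '' C)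
  have hm : ∀ p ∈ C, m ≤ proxEnergy p := fun p hp => csInf_le hbdd ⟨p, hp, rfl⟩
  obtain ⟨e, -, he_lim, he⟩ := exists_seq_tendsto_sInf (hne.image proxEnergy) hbdd
  choose p hpC hpe using he
  have hE_lim : Tendsto (fun n => proxEnergy (p n)) atTop (𝓝 m) := by simpa only [hpe] using he_lim
  have hcauchy : CauchySeq fun n => (p n).1 := by
    refine Metric.cauchySeq_iff'.2 fun ε hε => ?_
    have hsmall : ∀ᶠ n in atTop, proxEnergy (p n) < m + ε ^ 2 / 8 :=
      hE_lim.eventually_lt_const (by linarith [pow_pos hε 2])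
    obtain ⟨N, hN⟩ := eventually_atTop.1 hsmall
    refine ⟨N, fun n hn => ?_⟩
    rw [dist_eq_norm]
    refine lt_of_pow_lt_pow_left₀ 2 hε.le ?_
    linarith [sq_norm_sub_le_of_le_proxEnergy hC hm (hpC n) (hpC N), hN n hn, hN N le_rfl]
  obtain ⟨z, hz⟩ := cauchySeq_tendsto_of_complete hcauchy
  have hheight : Tendsto (fun n => (p n).2) atTop (𝓝 (m - ‖z‖ ^ 2 / 2)) := by
    simpa [proxEnergy] using hE_lim.sub ((hz.norm.pow 2).div_const 2)
  have hlim : Tendsto p atTop (𝓝 (z, m - ‖z‖ ^ 2 / 2)) := hz.prodMk_nhds hheight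
  refine ⟨_, hclosed.mem_of_tendsto hlim (.of_forall hpC), fun r hr => ?_⟩
  simpa [proxEnergy] using hm r hr

theorem nonneg_of_isMinOn_proxEnergy {C : Set (E × ℝ)} (hC : Convex ℝ C) {p r : E × ℝ}
    (hp : p ∈ C) (hmin : IsMinOn proxEnergy C p) (hr : r ∈ C) :
    0 ≤ r.2 - p.2 + ⟪p.1, r.1 - p.1⟫_ℝ := by
  set d := ‖p.1 - r.1‖ ^ 2 / 2 with hd
  have hslope : ∀ᶠ s in 𝓝[>] (0 : ℝ), 0 ≤ proxEnergy r - proxEnergy p - (1 - s) * d := by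
    filter_upwards [Ioc_mem_nhdsGT zero_lt_one] with s hs
    have hle : proxEnergy p ≤ proxEnergy ((1 - s) • p + s • r) :=
      hmin (hC hp hr (sub_nonneg.2 hs.2) hs.1.le (sub_add_cancel 1 s))
    rw [proxEnergy_convexComb] at hle
    refine nonneg_of_mul_nonneg_right (a := s) ?_ hs.1
    rw [hd]
    linarith
  have hlim : Tendsto (fun s : ℝ => proxEnergy r - proxEnergy p - (1 - s) * d) (𝓝[>] 0)
      (𝓝 (proxEnergy r - proxEnergy p - (1 - 0) * d)) :=
    (Continuous.tendsto (by fun_prop) 0).mono_left nhdsWithin_le_nhds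
  have hnonneg := ge_of_tendsto hlim hslope
  simp only [hd, proxEnergy, norm_sub_sq_real, inner_sub_right, real_inner_self_eq_norm_sq]
    at hnonneg ⊢
  linarith

end ProxEnergy

section Minty

variable {H : Type*} [NormedAddCommGroup H] [InnerProductSpace ℝ H] {A : H → Set H}

theorem isMaximalMonotone_iff : IsMaximalMonotone A ↔
    IsMonotoneOp A ∧ ∀ x u, (∀ y, ∀ v ∈ A y, 0 ≤ ⟪x - y, u - v⟫_ℝ) → u ∈ A x := by
  refine and_congr_right fun hmono => ⟨fun hmax x u hxu => ?_, fun hmem A' hA' hle => ?_⟩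
  · have hext := hmax (fun y => A y ∪ {v | y = x ∧ v = u}) ?_ fun y => Set.subset_union_left
    · rw [← hext]
      exact Or.inr ⟨rfl, rfl⟩
    · rintro y z v (hv | ⟨rfl, rfl⟩) w (hw | ⟨rfl, rfl⟩)
      · exact hmono y z v hv w hw
      · rw [← inner_neg_neg, neg_sub, neg_sub]
        exact hxu y v hv
      · exact hxu z w hw
      · simp
  · refine funext fun x => Set.Subset.antisymm (fun u hu => ?_) (hle x)
    exact hmem x u fun y v hv => hA' x y u hu v (hle y hv)

theorem IsMaximalMonotone.mem_of_forall (hA : IsMaximalMonotone A) {x u : H}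
    (h : ∀ y, ∀ v ∈ A y, 0 ≤ ⟪x - y, u - v⟫_ℝ) : u ∈ A x :=
  (isMaximalMonotone_iff.1 hA).2 x u h

theorem IsMaximalMonotone.exists_mem (hA : IsMaximalMonotone A) : ∃ x, (A x).Nonempty := by
  by_contra! hempty
  have hmem : (0 : H) ∈ A 0 := hA.mem_of_forall (by simp [hempty])
  simp [hempty] at hmem

theorem IsMaximalMonotone.comp_add_smul (hA : IsMaximalMonotone A) {c : ℝ} (hc : 0 < c) (y : H) :
    IsMaximalMonotone fun x => {w | c • w ∈ A (x + y)} := by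
  refine isMaximalMonotone_iff.2 ⟨fun x z u hu v hv => ?_, fun x u h => ?_⟩
  · have hmono := hA.1 _ _ _ hu _ hv
    rw [add_sub_add_right_eq_sub, ← smul_sub, inner_smul_right] at hmono
    exact nonneg_of_mul_nonneg_right hmono hc
  · refine hA.mem_of_forall fun z v hv => ?_
    have hmono := mul_nonneg hc.le (h (z - y) (c⁻¹ • v) (by simpa [smul_inv_smul₀ hc.ne'] using hv))
    rw [← inner_smul_right, smul_sub, smul_inv_smul₀ hc.ne'] at hmono
    rwa [show x + y - z = x - (z - y) by abel]

/-- The epigraph of the Fitzpatrick function `(x, u) ↦ sup {⟪y, u⟫ + ⟪x, v⟫ - ⟪y, v⟫ | v ∈ A y}`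
of the set-valued operator `A`. -/
def fitzpatrickEpigraph (A : H → Set H) : Set (WithLp 2 (H × H) × ℝ) :=
  {p | ∀ y, ∀ v ∈ A y, ⟪y, p.1.snd⟫_ℝ + ⟪p.1.fst, v⟫_ℝ - ⟪y, v⟫_ℝ ≤ p.2}

theorem isClosed_fitzpatrickEpigraph : IsClosed (fitzpatrickEpigraph A) := by
  simp only [fitzpatrickEpigraph, Set.ofPred_forall]
  refine isClosed_iInter fun y => isClosed_iInter fun v => isClosed_iInter fun _ => ?_
  exact isClosed_le (by fun_prop) (by fun_prop)

theorem convex_fitzpatrickEpigraph (A : H → Set H) : Convex ℝ (fitzpatrickEpigraph A) := by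
  intro p hp r hr s t hs ht hst y v hv
  have hcomb := add_le_add (mul_le_mul_of_nonneg_left (hp y v hv) hs)
    (mul_le_mul_of_nonneg_left (hr y v hv) ht)
  simp only [Prod.fst_add, Prod.snd_add, Prod.smul_fst, Prod.smul_snd, WithLp.add_fst,
    WithLp.add_snd, WithLp.smul_fst, WithLp.smul_snd, inner_add_left,
    inner_add_right, inner_smul_left, inner_smul_right, conj_trivial, smul_eq_mul]
  linear_combination hcomb + ⟪y, v⟫_ℝ * hst

theorem IsMonotoneOp.mem_fitzpatrickEpigraph (hA : IsMonotoneOp A) {x u : H} (hu : u ∈ A x) :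
    (WithLp.toLp 2 (x, u), ⟪x, u⟫_ℝ) ∈ fitzpatrickEpigraph A := by
  intro y v hv
  have hmono := hA x y u hu v hv
  simp only [inner_sub_left, inner_sub_right] at hmono
  simp only [WithLp.toLp_fst, WithLp.toLp_snd]
  linarith

theorem IsMaximalMonotone.inner_le_of_mem_fitzpatrickEpigraph (hA : IsMaximalMonotone A)
    {p : WithLp 2 (H × H) × ℝ} (hp : p ∈ fitzpatrickEpigraph A) :
    ⟪p.1.fst, p.1.snd⟫_ℝ ≤ p.2 := by
  by_contra! hlt
  have hmem : p.1.snd ∈ A p.1.fst := hA.mem_of_forall fun y v hv => by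
    have hpv := hp y v hv
    simp only [inner_sub_left, inner_sub_right]
    linarith
  linarith [hp _ _ hmem]

theorem bddBelow_proxEnergy_fitzpatrickEpigraph (hA : IsMaximalMonotone A) :
    BddBelow (proxEnergy '' fitzpatrickEpigraph A) := by
  refine ⟨0, ?_⟩
  rintro _ ⟨p, hp, rfl⟩
  have hinner := hA.inner_le_of_mem_fitzpatrickEpigraph hp
  have hsq := norm_add_sq_real p.1.fst p.1.snd
  rw [proxEnergy, WithLp.prod_norm_sq_eq_of_L2]
  linarith [sq_nonneg ‖p.1.fst + p.1.snd‖]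

theorem IsMaximalMonotone.sq_norm_le_inner_of_isMinOn (hA : IsMaximalMonotone A)
    {p : WithLp 2 (H × H) × ℝ} (hp : p ∈ fitzpatrickEpigraph A)
    (hmin : IsMinOn proxEnergy (fitzpatrickEpigraph A) p) {y v : H} (hv : v ∈ A y) :
    ‖p.1.fst + p.1.snd‖ ^ 2 ≤ ⟪-p.1.snd - y, -p.1.fst - v⟫_ℝ := by
  have hopt := nonneg_of_isMinOn_proxEnergy (convex_fitzpatrickEpigraph A) hp hmin
    (hA.1.mem_fitzpatrickEpigraph hv)
  have hinner := hA.inner_le_of_mem_fitzpatrickEpigraph hp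
  obtain ⟨z, t⟩ := p
  simp only [WithLp.prod_inner_apply, WithLp.ofLp_fst, WithLp.ofLp_snd, inner_sub_right,
    real_inner_self_eq_norm_sq] at hopt hinner
  simp only [norm_add_sq_real, inner_sub_left, inner_sub_right, inner_neg_left, inner_neg_right]
  rw [real_inner_comm z.fst z.snd, real_inner_comm z.fst y]
  linarith

theorem IsMaximalMonotone.exists_neg_mem [CompleteSpace H] (hA : IsMaximalMonotone A) :
    ∃ x, -x ∈ A x := by
  obtain ⟨y₀, v₀, hv₀⟩ := hA.exists_mem
  obtain ⟨p, hp, hmin⟩ := exists_isMinOn_proxEnergy (convex_fitzpatrickEpigraph A)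
    isClosed_fitzpatrickEpigraph ⟨_, hA.1.mem_fitzpatrickEpigraph hv₀⟩
    (bddBelow_proxEnergy_fitzpatrickEpigraph hA)
  have hmem : -p.1.fst ∈ A (-p.1.snd) := hA.mem_of_forall fun y v hv =>
    (sq_nonneg _).trans (hA.sq_norm_le_inner_of_isMinOn hp hmin hv)
  have hzero : p.1.fst + p.1.snd = 0 := by
    simpa using hA.sq_norm_le_inner_of_isMinOn hp hmin hmem
  exact ⟨p.1.fst, by rwa [neg_eq_of_add_eq_zero_left hzero] at hmem⟩

/-- Minty's theorem. -/
theorem IsMaximalMonotone.exists_smul_sub_mem [CompleteSpace H] (hA : IsMaximalMonotone A) {c : ℝ}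
    (hc : 0 < c) (y : H) : ∃ p, c • (y - p) ∈ A p := by
  obtain ⟨x, hx⟩ := (hA.comp_add_smul hc y).exists_neg_mem
  exact ⟨x + y, by simpa using hx⟩

theorem IsMonotoneOp.norm_sub_le_of_smul_sub_mem (hA : IsMonotoneOp A) {c : ℝ} (hc : 0 < c)
    {y z p q : H} (hp : c • (y - p) ∈ A p) (hq : c • (z - q) ∈ A q) : ‖p - q‖ ≤ ‖y - z‖ := by
  have hmono := hA _ _ _ hp _ hq
  rw [← smul_sub, inner_smul_right] at hmono
  have hfirm : ‖p - q‖ ^ 2 ≤ ⟪p - q, y - z⟫_ℝ := by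
    have hnonneg := nonneg_of_mul_nonneg_right hmono hc
    rw [sub_sub_sub_comm, inner_sub_right, real_inner_self_eq_norm_sq] at hnonneg
    linarith
  have hcs := real_inner_le_norm (p - q) (y - z)
  nlinarith [norm_nonneg (p - q), norm_nonneg (y - z)]

theorem norm_sub_smul_sub_sub_smul_le {x y u v : H} {c K : ℝ} (hK : 0 < K)
    (hmono : c * ‖x - y‖ ^ 2 ≤ ⟪x - y, u - v⟫_ℝ) (hlip : ‖u - v‖ ≤ K * ‖x - y‖) (hc : 0 ≤ c) :
    ‖(x - (c / K ^ 2) • u) - (y - (c / K ^ 2) • v)‖ ≤ √(1 - c ^ 2 / K ^ 2) * ‖x - y‖ := by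
  rw [← Real.sqrt_sq (norm_nonneg (x - y)), ← Real.sqrt_mul' _ (sq_nonneg _)]
  refine Real.le_sqrt_of_sq_le ?_
  have hsq : ‖u - v‖ ^ 2 ≤ K ^ 2 * ‖x - y‖ ^ 2 := by
    rw [← mul_pow]
    exact pow_le_pow_left₀ (norm_nonneg _) hlip 2
  rw [sub_sub_sub_comm, ← smul_sub, norm_sub_sq_real, inner_smul_right, norm_smul, mul_pow,
    Real.norm_eq_abs, sq_abs]
  calc ‖x - y‖ ^ 2 - 2 * (c / K ^ 2 * ⟪x - y, u - v⟫_ℝ) + (c / K ^ 2) ^ 2 * ‖u - v‖ ^ 2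
      ≤ ‖x - y‖ ^ 2 - 2 * (c / K ^ 2 * (c * ‖x - y‖ ^ 2))
        + (c / K ^ 2) ^ 2 * (K ^ 2 * ‖x - y‖ ^ 2) := by gcongr
    _ = (1 - c ^ 2 / K ^ 2) * ‖x - y‖ ^ 2 := by
      field_simp
      ring

theorem IsMaximalMonotone.exists_sub_mem [CompleteSpace H] (hA : IsMaximalMonotone A) {L : H → H}
    {c K : ℝ} (hc : 0 < c) (hK : 0 < K) (hmono : ∀ x y, c * ‖x - y‖ ^ 2 ≤ ⟪x - y, L x - L y⟫_ℝ)
    (hlip : ∀ x y, ‖L x - L y‖ ≤ K * ‖x - y‖) (z : H) : ∃ p, z - L p ∈ A p := by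
  set τ := c / K ^ 2
  have hτ : 0 < τ := by positivity
  choose J hJ using hA.exists_smul_sub_mem (inv_pos.2 hτ)
  have hcontr : ContractingWith (√(1 - c ^ 2 / K ^ 2)).toNNReal
      fun p => J (p - τ • L p + τ • z) := by
    refine ⟨by simpa [Real.sqrt_lt'] using by positivity, .of_dist_le_mul fun x y => ?_⟩
    rw [dist_eq_norm, dist_eq_norm, Real.coe_toNNReal _ (Real.sqrt_nonneg _)]
    refine (hA.1.norm_sub_le_of_smul_sub_mem (inv_pos.2 hτ) (hJ _) (hJ _)).trans ?_
    rw [add_sub_add_right_eq_sub]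
    exact norm_sub_smul_sub_sub_smul_le hK (hmono x y) (hlip x y) hc.le
  obtain ⟨p, hp⟩ : ∃ p, J (p - τ • L p + τ • z) = p := ⟨_, hcontr.fixedPoint_isFixedPt⟩
  have hmem := hJ (p - τ • L p + τ • z)
  rw [hp, show p - τ • L p + τ • z - p = τ • (z - L p) by rw [smul_sub]; abel,
    inv_smul_smul₀ hτ.ne'] at hmem
  exact ⟨p, hmem⟩

end Minty

section Metric

variable {H : Type*} [NormedAddCommGroup H] [InnerProductSpace ℝ H]

theorem inner_map_comm {V : H →L[ℝ] H} (hV : V.IsPositive) (x y : H) :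
    ⟪V x, y⟫_ℝ = ⟪V y, x⟫_ℝ := by
  rw [hV.inner_left_eq_inner_right, real_inner_comm]

theorem inner_map_add_add {V : H →L[ℝ] H} (hV : V.IsPositive) (x y : H) :
    ⟪V (x + y), x + y⟫_ℝ = ⟪V x, x⟫_ℝ + 2 * ⟪V x, y⟫_ℝ + ⟪V y, y⟫_ℝ := by
  simp only [map_add, inner_add_left, inner_add_right, inner_map_comm hV y x]
  ring

theorem inner_map_sub_sub {V : H →L[ℝ] H} (hV : V.IsPositive) (x y : H) :
    ⟪V (x - y), x - y⟫_ℝ = ⟪V x, x⟫_ℝ - 2 * ⟪V x, y⟫_ℝ + ⟪V y, y⟫_ℝ := by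
  simp only [map_sub, inner_sub_left, inner_sub_right, inner_map_comm hV y x]
  ring

theorem metricNorm_nonneg (V : H →L[ℝ] H) (x : H) : 0 ≤ metricNorm V x := Real.sqrt_nonneg _

theorem metricNorm_sq {V : H →L[ℝ] H} (hV : V.IsPositive) (x : H) :
    metricNorm V x ^ 2 = ⟪V x, x⟫_ℝ := Real.sq_sqrt (hV.inner_nonneg_left x)

theorem metricNorm_smul (V : H →L[ℝ] H) (s : ℝ) (x : H) :
    metricNorm V (s • x) = |s| * metricNorm V x := by
  rw [metricNorm, metricNorm, map_smul, inner_smul_left, inner_smul_right, conj_trivial,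
    ← mul_assoc, Real.sqrt_mul (mul_self_nonneg s), Real.sqrt_mul_self_eq_abs]

theorem sq_inner_map_le {V : H →L[ℝ] H} (hV : V.IsPositive) (x y : H) :
    ⟪V x, y⟫_ℝ ^ 2 ≤ ⟪V x, x⟫_ℝ * ⟪V y, y⟫_ℝ :=
  LinearMap.BilinForm.apply_sq_le_of_symm (innerₗ H ∘ₗ (V : H →ₗ[ℝ] H)) hV.inner_nonneg_left
    ⟨inner_map_comm hV⟩ x y

theorem abs_inner_map_le {V : H →L[ℝ] H} (hV : V.IsPositive) (x y : H) :
    |⟪V x, y⟫_ℝ| ≤ metricNorm V x * metricNorm V y := by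
  refine abs_le_of_sq_le_sq ?_ (mul_nonneg (metricNorm_nonneg _ _) (metricNorm_nonneg _ _))
  rw [mul_pow, metricNorm_sq hV, metricNorm_sq hV]
  exact sq_inner_map_le hV x y

theorem metricNorm_add_le {V : H →L[ℝ] H} (hV : V.IsPositive) (x y : H) :
    metricNorm V (x + y) ≤ metricNorm V x + metricNorm V y := by
  refine Real.sqrt_le_iff.2 ⟨add_nonneg (metricNorm_nonneg _ _) (metricNorm_nonneg _ _), ?_⟩
  rw [inner_map_add_add hV, add_sq, metricNorm_sq hV, metricNorm_sq hV]
  linarith [le_of_abs_le (abs_inner_map_le hV x y)]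

section StrongPos

variable [CompleteSpace H] {α : ℝ} {U : H →L[ℝ] H}

theorem mul_sq_norm_le_of_mem_strongPos (hU : U ∈ strongPos α) (x : H) :
    α * ‖x‖ ^ 2 ≤ ⟪U x, x⟫_ℝ := by
  have hnonneg := ((ContinuousLinearMap.le_def _ _).1 hU.2).inner_nonneg_left x
  simpa [inner_sub_left, inner_smul_left] using hnonneg

theorem isPositive_of_mem_strongPos (hα : 0 < α) (hU : U ∈ strongPos α) : U.IsPositive :=
  ⟨hU.1.isSymmetric, fun x =>
    (by positivity : 0 ≤ α * ‖x‖ ^ 2).trans (mul_sq_norm_le_of_mem_strongPos hU x)⟩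

theorem map_inverse_of_mem_strongPos (hα : 0 < α) (hU : U ∈ strongPos α) (x : H) :
    U (U.inverse x) = x :=
  (inverse_of_mem_strongPos hα hU).1 x

theorem inner_inverse_left_of_mem_strongPos (hα : 0 < α) (hU : U ∈ strongPos α) (x y : H) :
    ⟪U.inverse x, y⟫_ℝ = ⟪x, U.inverse y⟫_ℝ := by
  conv_lhs => rw [← map_inverse_of_mem_strongPos hα hU y,
    ← (isPositive_of_mem_strongPos hα hU).inner_left_eq_inner_right,
    map_inverse_of_mem_strongPos hα hU]

theorem isPositive_inverse_of_mem_strongPos (hα : 0 < α) (hU : U ∈ strongPos α) :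
    U.inverse.IsPositive := by
  refine ⟨inner_inverse_left_of_mem_strongPos hα hU, fun x => ?_⟩
  have hnonneg := (isPositive_of_mem_strongPos hα hU).inner_nonneg_right (U.inverse x)
  rwa [map_inverse_of_mem_strongPos hα hU] at hnonneg

theorem mul_norm_inverse_le_of_mem_strongPos (hα : 0 < α) (hU : U ∈ strongPos α) (x : H) :
    α * ‖U.inverse x‖ ≤ ‖x‖ := by
  have hcoer := mul_sq_norm_le_of_mem_strongPos hU (U.inverse x)
  rw [map_inverse_of_mem_strongPos hα hU] at hcoer
  rcases (norm_nonneg (U.inverse x)).eq_or_lt with hzero | hpos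
  · simp [← hzero]
  · refine le_of_mul_le_mul_right ?_ hpos
    linarith [real_inner_le_norm x (U.inverse x)]

theorem metricNorm_inverse_le (hα : 0 < α) (hU : U ∈ strongPos α) (x : H) :
    metricNorm U.inverse x ≤ ‖x‖ / √α := by
  rw [metricNorm, ← Real.sqrt_sq (norm_nonneg x), ← Real.sqrt_div (sq_nonneg _)]
  refine Real.sqrt_le_sqrt ((le_div_iff₀' hα).2 ?_)
  calc α * ⟪U.inverse x, x⟫_ℝ ≤ α * (‖U.inverse x‖ * ‖x‖) := by
        gcongr
        exact real_inner_le_norm _ _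
    _ = α * ‖U.inverse x‖ * ‖x‖ := (mul_assoc _ _ _).symm
    _ ≤ ‖x‖ * ‖x‖ := by
        gcongr
        exact mul_norm_inverse_le_of_mem_strongPos hα hU x
    _ = ‖x‖ ^ 2 := (sq _).symm

theorem inner_inverse_le_mul (hα : 0 < α) (hU : U ∈ strongPos α) {α' : ℝ} (hα' : 0 < α')
    {U' : H →L[ℝ] H} (hU' : U' ∈ strongPos α') {c : ℝ} (hc : 0 < c) (hle : U ≤ c • U') (x : H) :
    ⟪U'.inverse x, x⟫_ℝ ≤ c * ⟪U.inverse x, x⟫_ℝ := by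
  set y := U'.inverse x with hy
  have hsquare := (isPositive_of_mem_strongPos hα hU).inner_nonneg_left (c • U.inverse x - y)
  have hUy := ((ContinuousLinearMap.le_def _ _).1 hle).inner_nonneg_left y
  rw [inner_map_sub_sub (isPositive_of_mem_strongPos hα hU)] at hsquare
  simp only [map_smul, map_inverse_of_mem_strongPos hα hU, inner_smul_left, inner_smul_right,
    conj_trivial] at hsquare
  simp only [sub_apply, smul_apply, inner_sub_left, inner_smul_left, conj_trivial, hy,
    map_inverse_of_mem_strongPos hα' hU'] at hUy
  rw [← hy, real_inner_comm y x] at hUy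
  rw [real_inner_comm (U.inverse x) x, real_inner_comm y x] at hsquare
  refine le_of_mul_le_mul_left ?_ hc
  linarith

theorem sq_norm_le_mul_inner_inverse (hα : 0 < α) (hU : U ∈ strongPos α) {m : ℝ} (hUm : ‖U‖ ≤ m)
    (x : H) : ‖x‖ ^ 2 ≤ m * ⟪U.inverse x, x⟫_ℝ := by
  have hcs := sq_inner_map_le (isPositive_of_mem_strongPos hα hU) (U.inverse x) x
  rw [map_inverse_of_mem_strongPos hα hU, real_inner_self_eq_norm_sq, real_inner_comm] at hcs
  rcases (sq_nonneg ‖x‖).eq_or_lt with hzero | hpos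
  · have hx : x = 0 := by simpa using hzero.symm
    simp [hx]
  · refine le_of_mul_le_mul_right ?_ hpos
    calc ‖x‖ ^ 2 * ‖x‖ ^ 2 ≤ ⟪U.inverse x, x⟫_ℝ * ⟪U x, x⟫_ℝ := by rwa [← sq]
      _ ≤ ⟪U.inverse x, x⟫_ℝ * (m * ‖x‖ * ‖x‖) := by
        gcongr
        · exact (isPositive_inverse_of_mem_strongPos hα hU).inner_nonneg_left x
        · exact (real_inner_le_norm _ _).trans (by gcongr; exact U.le_of_opNorm_le hUm x)
      _ = m * ⟪U.inverse x, x⟫_ℝ * ‖x‖ ^ 2 := by ring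

theorem norm_le_metricNorm_inverse (hα : 0 < α) (hU : U ∈ strongPos α) {m : ℝ} (hUm : ‖U‖ ≤ m)
    (x : H) : ‖x‖ ≤ √m * metricNorm U.inverse x := by
  rw [metricNorm, ← Real.sqrt_mul ((norm_nonneg U).trans hUm)]
  exact Real.le_sqrt_of_sq_le (sq_norm_le_mul_inner_inverse hα hU hUm x)

end StrongPos

end Metric

section ForwardBackward

variable {H : Type*} [NormedAddCommGroup H] {A : H → Set H} {B : H → H}

theorem mem_zer_addSingle_iff {x : H} : x ∈ zer (addSingle A B) ↔ -B x ∈ A x :=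
  ⟨fun ⟨_, hu, h⟩ => by rwa [← eq_neg_of_add_eq_zero_left h.symm],
    fun h => ⟨-B x, h, (neg_add_cancel _).symm⟩⟩

variable [InnerProductSpace ℝ H]

theorem IsCocoercive.mul_norm_sub_le {β : ℝ} (hB : IsCocoercive β B) (x y : H) :
    β * ‖B x - B y‖ ≤ ‖x - y‖ := by
  rcases (norm_nonneg (B x - B y)).eq_or_lt with hzero | hpos
  · simp [← hzero]
  · refine le_of_mul_le_mul_right ?_ hpos
    linarith [hB x y, real_inner_le_norm (x - y) (B x - B y)]

theorem IsMonotoneOp.metricNorm_sub_le (hA : IsMonotoneOp A) {V : H →L[ℝ] H} (hV : V.IsPositive)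
    {c : ℝ} (hc : 0 < c) {y z p q : H} (hp : c • V (y - p) ∈ A p) (hq : c • V (z - q) ∈ A q) :
    metricNorm V (p - q) ≤ metricNorm V (y - z) := by
  have hmono := hA _ _ _ hp _ hq
  rw [← smul_sub, inner_smul_right, ← map_sub, sub_sub_sub_comm, ← hV.inner_left_eq_inner_right,
    inner_sub_right, ← metricNorm_sq hV] at hmono
  have hfirm := nonneg_of_mul_nonneg_right hmono hc
  have hcs := le_of_abs_le (abs_inner_map_le hV (p - q) (y - z))
  rcases (metricNorm_nonneg V (p - q)).eq_or_lt with hzero | hpos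
  · rw [← hzero]
    exact metricNorm_nonneg _ _
  · exact le_of_mul_le_mul_left (by linarith) hpos

theorem inner_map_le_opNorm_mul_sq (V : H →L[ℝ] H) (x : H) : ⟪V x, x⟫_ℝ ≤ ‖V‖ * ‖x‖ ^ 2 := by
  rw [sq, ← mul_assoc]
  exact (real_inner_le_norm _ _).trans (by gcongr; exact V.le_opNorm x)

/-- The residual `x - T x` of the forward-backward operator `T = J_{γUA}(I - γUB)`. -/
noncomputable def fbResidual (A : H → Set H) (B : H → H) (γ : ℝ) (U : H →L[ℝ] H) (x : H) : H :=
  x - fbOp A B γ U x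

theorem sub_fbResidual (x : H) : x - fbResidual A B γ U x = fbOp A B γ U x := sub_sub_cancel _ _

variable [CompleteSpace H] {α β γ : ℝ} {U : H →L[ℝ] H}

theorem mem_invIdAdd_scaledOp_iff (hα : 0 < α) (hU : U ∈ strongPos α) (hγ : 0 < γ) {y p : H} :
    p ∈ invIdAdd (scaledOp γ U A) y ↔ γ⁻¹ • U.inverse (y - p) ∈ A p := by
  obtain ⟨hright, hleft⟩ := inverse_of_mem_strongPos hα hU
  constructor
  · rintro ⟨_, ⟨u, hu, rfl⟩, rfl⟩
    simpa [hleft, hγ.ne'] using hu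
  · refine fun h => ⟨y - p, ⟨_, h, ?_⟩, (add_sub_cancel p y).symm⟩
    rw [map_smul, hright, smul_inv_smul₀ hγ.ne']

theorem IsMaximalMonotone.invIdAdd_scaledOp_nonempty (hA : IsMaximalMonotone A) (hα : 0 < α)
    (hU : U ∈ strongPos α) (hγ : 0 < γ) (y : H) : (invIdAdd (scaledOp γ U A) y).Nonempty := by
  have hmono (x z : H) : γ⁻¹ * (‖U‖ + 1)⁻¹ * ‖x - z‖ ^ 2 ≤
      ⟪x - z, γ⁻¹ • U.inverse x - γ⁻¹ • U.inverse z⟫_ℝ := by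
    rw [← smul_sub, ← map_sub, inner_smul_right, real_inner_comm, mul_assoc]
    gcongr
    rw [inv_mul_le_iff₀ (by positivity)]
    exact sq_norm_le_mul_inner_inverse hα hU (by linarith) _
  have hlip (x z : H) :
      ‖γ⁻¹ • U.inverse x - γ⁻¹ • U.inverse z‖ ≤ γ⁻¹ * α⁻¹ * ‖x - z‖ := by
    rw [← smul_sub, ← map_sub, norm_smul, Real.norm_of_nonneg (inv_nonneg.2 hγ.le), mul_assoc]
    gcongr
    rw [← div_eq_inv_mul, le_div_iff₀' hα]
    exact mul_norm_inverse_le_of_mem_strongPos hα hU _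
  obtain ⟨p, hp⟩ := hA.exists_sub_mem (by positivity) (by positivity) hmono hlip
    (γ⁻¹ • U.inverse y)
  refine ⟨p, (mem_invIdAdd_scaledOp_iff hα hU hγ).2 ?_⟩
  rwa [map_sub, smul_sub]

theorem IsMaximalMonotone.smul_inverse_sub_resolvent_mem (hA : IsMaximalMonotone A) (hα : 0 < α)
    (hU : U ∈ strongPos α) (hγ : 0 < γ) (y : H) :
    γ⁻¹ • U.inverse (y - resolvent (scaledOp γ U A) y) ∈ A (resolvent (scaledOp γ U A) y) :=
  (mem_invIdAdd_scaledOp_iff hα hU hγ).1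
    (Classical.epsilon_spec (hA.invIdAdd_scaledOp_nonempty hα hU hγ y))

theorem IsMaximalMonotone.metricNorm_resolvent_sub_le (hA : IsMaximalMonotone A) (hα : 0 < α)
    (hU : U ∈ strongPos α) (hγ : 0 < γ) (y z : H) :
    metricNorm U.inverse (resolvent (scaledOp γ U A) y - resolvent (scaledOp γ U A) z) ≤
      metricNorm U.inverse (y - z) :=
  hA.1.metricNorm_sub_le (isPositive_inverse_of_mem_strongPos hα hU) (inv_pos.2 hγ)
    (hA.smul_inverse_sub_resolvent_mem hα hU hγ y) (hA.smul_inverse_sub_resolvent_mem hα hU hγ z)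

theorem inner_inverse_sub_smul_map (hα : 0 < α) (hU : U ∈ strongPos α) (c : ℝ) (z d : H) :
    ⟪U.inverse (c • U d - z), c • U d - z⟫_ℝ =
      c ^ 2 * ⟪U d, d⟫_ℝ - 2 * c * ⟪z, d⟫_ℝ + ⟪U.inverse z, z⟫_ℝ := by
  rw [inner_map_sub_sub (isPositive_inverse_of_mem_strongPos hα hU)]
  simp only [map_smul, (inverse_of_mem_strongPos hα hU).2, inner_smul_left, inner_smul_right,
    conj_trivial, real_inner_comm (U d) d, real_inner_comm z d]
  ring

theorem metricNorm_sub_smul_map_le (hα : 0 < α) (hU : U ∈ strongPos α) (hγ : 0 < γ)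
    (hγU : γ * ‖U‖ ≤ 2 * β) {z d : H} (hzd : β * ‖d‖ ^ 2 ≤ ⟪z, d⟫_ℝ) :
    metricNorm U.inverse (z - γ • U d) ≤ metricNorm U.inverse z := by
  refine Real.sqrt_le_sqrt ?_
  rw [← neg_sub, map_neg, inner_neg_neg, inner_inverse_sub_smul_map hα hU]
  have hbound : γ ^ 2 * ⟪U d, d⟫_ℝ ≤ 2 * γ * ⟪z, d⟫_ℝ := calc
    γ ^ 2 * ⟪U d, d⟫_ℝ ≤ γ ^ 2 * (‖U‖ * ‖d‖ ^ 2) := by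
      gcongr
      exact inner_map_le_opNorm_mul_sq U d
    _ = γ * (γ * ‖U‖) * ‖d‖ ^ 2 := by ring
    _ ≤ γ * (2 * β) * ‖d‖ ^ 2 := by gcongr
    _ = 2 * γ * (β * ‖d‖ ^ 2) := by ring
    _ ≤ 2 * γ * ⟪z, d⟫_ℝ := by gcongr
  linarith

theorem metricNorm_fbOp_sub_le (hA : IsMaximalMonotone A) (hB : IsCocoercive β B) (hα : 0 < α)
    (hU : U ∈ strongPos α) (hγ : 0 < γ) (hγU : γ * ‖U‖ ≤ 2 * β) (x y : H) :
    metricNorm U.inverse (fbOp A B γ U x - fbOp A B γ U y) ≤ metricNorm U.inverse (x - y) := by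
  refine (hA.metricNorm_resolvent_sub_le hα hU hγ _ _).trans ?_
  rw [sub_sub_sub_comm, ← smul_sub, ← map_sub]
  exact metricNorm_sub_smul_map_le hα hU hγ hγU (hB x y)

theorem norm_fbOp_sub_le (hA : IsMaximalMonotone A) (hB : IsCocoercive β B) (hα : 0 < α)
    (hU : U ∈ strongPos α) (hγ : 0 < γ) (hγU : γ * ‖U‖ ≤ 2 * β) {m : ℝ} (hUm : ‖U‖ ≤ m) (x y : H) :
    ‖fbOp A B γ U x - fbOp A B γ U y‖ ≤ √m / √α * ‖x - y‖ :=
  calc ‖fbOp A B γ U x - fbOp A B γ U y‖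
      ≤ √m * metricNorm U.inverse (fbOp A B γ U x - fbOp A B γ U y) :=
        norm_le_metricNorm_inverse hα hU hUm _
    _ ≤ √m * metricNorm U.inverse (x - y) := by
        gcongr
        exact metricNorm_fbOp_sub_le hA hB hα hU hγ hγU x y
    _ ≤ √m * (‖x - y‖ / √α) := by
        gcongr
        exact metricNorm_inverse_le hα hU _
    _ = √m / √α * ‖x - y‖ := by ring

theorem smul_inverse_fbResidual_sub_mem (hA : IsMaximalMonotone A) (hα : 0 < α)
    (hU : U ∈ strongPos α) (hγ : 0 < γ) (x : H) :
    γ⁻¹ • U.inverse (fbResidual A B γ U x) - B x ∈ A (fbOp A B γ U x) := by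
  have hmem := hA.smul_inverse_sub_resolvent_mem hα hU hγ (x - γ • U (B x))
  rwa [← fbOp, sub_right_comm, map_sub, map_smul, (inverse_of_mem_strongPos hα hU).2, smul_sub,
    inv_smul_smul₀ hγ.ne'] at hmem

theorem inner_sub_fbResidual_nonneg (hA : IsMaximalMonotone A) (hα : 0 < α) (hU : U ∈ strongPos α)
    (hγ : 0 < γ) (x : H) {xs : H} (hxs : xs ∈ zer (addSingle A B)) :
    0 ≤ ⟪x - xs - fbResidual A B γ U x,
      U.inverse (fbResidual A B γ U x) - γ • (B x - B xs)⟫_ℝ := by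
  have hmono := hA.1 _ _ _ (smul_inverse_fbResidual_sub_mem (B := B) hA hα hU hγ x) _
    (mem_zer_addSingle_iff.1 hxs)
  have hscaled := mul_nonneg hγ.le hmono
  rwa [← inner_smul_right, sub_neg_eq_add, sub_add, smul_sub, smul_inv_smul₀ hγ.ne',
    ← sub_fbResidual, sub_right_comm] at hscaled

theorem norm_fbResidual_sub_le (hA : IsMaximalMonotone A) (hB : IsCocoercive β B) (hα : 0 < α)
    (hU : U ∈ strongPos α) (hγ : 0 < γ) (hγU : γ * ‖U‖ ≤ 2 * β) {m : ℝ} (hUm : ‖U‖ ≤ m) (x y : H) :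
    ‖fbResidual A B γ U x - fbResidual A B γ U y‖ ≤ (1 + √m / √α) * ‖x - y‖ := by
  rw [fbResidual, fbResidual, sub_sub_sub_comm, add_mul, one_mul]
  exact (norm_sub_le _ _).trans (by gcongr; exact norm_fbOp_sub_le hA hB hα hU hγ hγU hUm x y)

theorem inner_inverse_fbResidual_sub_le (hA : IsMaximalMonotone A) (hα : 0 < α)
    (hU : U ∈ strongPos α) (hγ : 0 < γ) {γ' : ℝ} {U' : H →L[ℝ] H} (hU' : U' ∈ strongPos α)
    (hγ' : 0 < γ') {x v v' : H} (hv : fbResidual A B γ U x = v)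
    (hv' : fbResidual A B γ' U' x = v') :
    ⟪U'.inverse (v' - v), v' - v⟫_ℝ ≤
      ⟪v' - v, ((γ' - γ) / γ) • U.inverse v + (U.inverse v - U'.inverse v)⟫_ℝ := by
  have hmem := smul_inverse_fbResidual_sub_mem (B := B) hA hα hU hγ x
  have hmem' := smul_inverse_fbResidual_sub_mem (B := B) hA hα hU' hγ' x
  rw [← sub_fbResidual, hv] at hmem
  rw [← sub_fbResidual, hv'] at hmem'
  have hscaled := mul_nonneg hγ'.le (hA.1 _ _ _ hmem _ hmem')
  rw [← inner_smul_right, sub_sub_sub_cancel_left, sub_sub_sub_cancel_right, smul_sub, smul_smul,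
    smul_inv_smul₀ hγ'.ne'] at hscaled
  rw [real_inner_comm, ← sub_nonneg, ← inner_sub_right, map_sub]
  have hsplit : ((γ' - γ) / γ) • U.inverse v = (γ' * γ⁻¹) • U.inverse v - U.inverse v := by
    rw [sub_div, div_self hγ.ne', sub_smul, one_smul, div_eq_mul_inv]
  rwa [hsplit, show (γ' * γ⁻¹) • U.inverse v - U.inverse v + (U.inverse v - U'.inverse v) -
    (U'.inverse v' - U'.inverse v) = (γ' * γ⁻¹) • U.inverse v - U'.inverse v' by abel]

theorem norm_fbResidual_change_le (hA : IsMaximalMonotone A) (hα : 0 < α) (hU : U ∈ strongPos α)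
    (hγ : 0 < γ) {γ' : ℝ} {U' : H →L[ℝ] H} (hU' : U' ∈ strongPos α) (hγ' : 0 < γ') {m : ℝ}
    (hUm : ‖U'‖ ≤ m) {x v v' : H} (hv : fbResidual A B γ U x = v)
    (hv' : fbResidual A B γ' U' x = v') :
    ‖v' - v‖ ≤ m * (|γ' - γ| / γ * (‖v‖ / α) + ‖U.inverse v - U'.inverse v‖) := by
  set e := ((γ' - γ) / γ) • U.inverse v + (U.inverse v - U'.inverse v)
  have hm : 0 ≤ m := (norm_nonneg _).trans hUm
  have he : ‖e‖ ≤ |γ' - γ| / γ * (‖v‖ / α) + ‖U.inverse v - U'.inverse v‖ := by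
    refine (norm_add_le _ _).trans ?_
    rw [norm_smul, Real.norm_eq_abs, abs_div, abs_of_pos hγ]
    gcongr
    rw [le_div_iff₀' hα]
    exact mul_norm_inverse_le_of_mem_strongPos hα hU v
  have hsq : ‖v' - v‖ ^ 2 ≤ m * (‖v' - v‖ * ‖e‖) := by
    refine (sq_norm_le_mul_inner_inverse hα hU' hUm _).trans ?_
    gcongr
    exact (inner_inverse_fbResidual_sub_le hA hα hU hγ hU' hγ' hv hv').trans
      (real_inner_le_norm _ _)
  refine le_trans ?_ (mul_le_mul_of_nonneg_left he hm)
  rcases (norm_nonneg (v' - v)).eq_or_lt with hzero | hpos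
  · rw [← hzero]
    positivity
  · exact le_of_mul_le_mul_left (by linarith) hpos

end ForwardBackward

section Gap

variable {H : Type*} [NormedAddCommGroup H] [InnerProductSpace ℝ H]

/-- A lower bound, per unit of relaxation, for the decrease of `‖z‖_W²` under the relaxed step
`z ↦ z - λ v`. It is used for `z = x - x*`, the forward-backward residual `v` at `x` and
`κ = γ‖U‖ / (2β)`, so that `2 - κ` is the inverse of the averagedness constant. -/
noncomputable def fbGap (κ : ℝ) (W : H →L[ℝ] H) (z v : H) : ℝ :=
  2 * ⟪W z, v⟫_ℝ - (2 - κ) * ⟪W v, v⟫_ℝ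

theorem sq_metricNorm_sub_smul_le {W : H →L[ℝ] H} (hW : W.IsPositive) {κ s : ℝ} (hs : 0 ≤ s)
    (hsκ : s ≤ 2 - κ) (z v : H) :
    metricNorm W (z - s • v) ^ 2 ≤ metricNorm W z ^ 2 - s * fbGap κ W z v := by
  have hslack := mul_nonneg (mul_nonneg hs (sub_nonneg.2 hsκ)) (hW.inner_nonneg_left v)
  rw [metricNorm_sq hW, metricNorm_sq hW, inner_map_sub_sub hW, fbGap]
  simp only [map_smul, inner_smul_left, inner_smul_right, conj_trivial]
  linarith

variable [CompleteSpace H] {α β γ κ : ℝ} {U : H →L[ℝ] H} {z v d : H}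

theorem metricNorm_inverse_sq_le_mul_fbGap (hα : 0 < α) (hU : U ∈ strongPos α) (hγ : 0 ≤ γ)
    (hκ : 0 ≤ κ) (hγU : γ * ‖U‖ ≤ 2 * β * κ) (hzd : β * ‖d‖ ^ 2 ≤ ⟪z, d⟫_ℝ)
    (hzv : 0 ≤ ⟪z - v, U.inverse v - γ • d⟫_ℝ) :
    metricNorm U.inverse (γ • U d - κ • v) ^ 2 ≤ κ * fbGap κ U.inverse z v := by
  have hforward : γ ^ 2 * ⟪U d, d⟫_ℝ ≤ κ * (2 * γ * ⟪z, d⟫_ℝ) := calc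
    γ ^ 2 * ⟪U d, d⟫_ℝ ≤ γ ^ 2 * (‖U‖ * ‖d‖ ^ 2) := by
      gcongr
      exact inner_map_le_opNorm_mul_sq U d
    _ = γ * (γ * ‖U‖) * ‖d‖ ^ 2 := by ring
    _ ≤ γ * (2 * β * κ) * ‖d‖ ^ 2 := by gcongr
    _ = κ * (2 * γ * (β * ‖d‖ ^ 2)) := by ring
    _ ≤ κ * (2 * γ * ⟪z, d⟫_ℝ) := by gcongr
  have hbackward := mul_nonneg hκ hzv
  rw [metricNorm_sq (isPositive_inverse_of_mem_strongPos hα hU), inner_inverse_sub_smul_map hα hU,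
    fbGap]
  simp only [map_smul, inner_sub_left, inner_sub_right, inner_smul_left, inner_smul_right,
    conj_trivial, real_inner_comm (U.inverse v) v,
    inner_inverse_left_of_mem_strongPos hα hU z v] at hbackward ⊢
  linarith

theorem fbGap_nonneg (hα : 0 < α) (hU : U ∈ strongPos α) (hγ : 0 < γ)
    (hκ : 0 ≤ κ) (hγU : γ * ‖U‖ ≤ 2 * β * κ) (hzd : β * ‖d‖ ^ 2 ≤ ⟪z, d⟫_ℝ)
    (hzv : 0 ≤ ⟪z - v, U.inverse v - γ • d⟫_ℝ) : 0 ≤ fbGap κ U.inverse z v := by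
  rcases hκ.eq_or_lt with rfl | hpos
  · have hUzero : U = 0 := norm_le_zero_iff.1 (nonpos_of_mul_nonpos_right (by simpa using hγU) hγ)
    have hv : v = 0 := by
      rw [← map_inverse_of_mem_strongPos hα hU v]
      simp [hUzero]
    simp [fbGap, hv]
  · exact nonneg_of_mul_nonneg_right
      ((sq_nonneg _).trans (metricNorm_inverse_sq_le_mul_fbGap hα hU hγ.le hκ hγU hzd hzv)) hpos

theorem mul_inner_inverse_le_mul_fbGap_sub (hα : 0 < α) (hU : U ∈ strongPos α)
    (hzv : 0 ≤ ⟪z - v, U.inverse v - γ • d⟫_ℝ) :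
    κ * (1 - κ) * ⟪U.inverse v, v⟫_ℝ ≤
      (1 - κ) * fbGap κ U.inverse z v - 2 * ⟪U.inverse (z - v), γ • U d - κ • v⟫_ℝ := by
  have hWU : ⟪U.inverse (z - v), U d⟫_ℝ = ⟪z - v, d⟫_ℝ := by
    rw [inner_inverse_left_of_mem_strongPos hα hU, (inverse_of_mem_strongPos hα hU).2]
  rw [inner_sub_right, inner_smul_right, inner_smul_right, hWU, fbGap]
  rw [inner_sub_right, inner_smul_right, ← inner_inverse_left_of_mem_strongPos hα hU] at hzv
  simp only [map_sub, inner_sub_left] at hzv ⊢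
  linarith

theorem mul_inner_inverse_le_mul_sqrt_fbGap (hα : 0 < α) (hU : U ∈ strongPos α) (hγ : 0 < γ)
    (hκ : 0 ≤ κ) (hκ' : κ ≤ 1) (hγU : γ * ‖U‖ ≤ 2 * β * κ) (hzd : β * ‖d‖ ^ 2 ≤ ⟪z, d⟫_ℝ)
    (hzv : 0 ≤ ⟪z - v, U.inverse v - γ • d⟫_ℝ) :
    κ * (1 - κ) * ⟪U.inverse v, v⟫_ℝ ≤
      3 * metricNorm U.inverse z * √(fbGap κ U.inverse z v) := by
  have hW : U.inverse.IsPositive := isPositive_inverse_of_mem_strongPos hα hU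
  set G := fbGap κ U.inverse z v
  set g := γ • U d - κ • v
  have hG : 0 ≤ G := fbGap_nonneg hα hU hγ hκ hγU hzd hzv
  have hdecr : metricNorm U.inverse (z - v) ^ 2 ≤ metricNorm U.inverse z ^ 2 - G := by
    simpa using sq_metricNorm_sub_smul_le hW zero_le_one (by linarith : 1 ≤ 2 - κ) z v
  have hG_le : √G ≤ metricNorm U.inverse z := Real.sqrt_le_iff.2
    ⟨metricNorm_nonneg _ _, by linarith [sq_nonneg (metricNorm U.inverse (z - v))]⟩
  have hzv_le : metricNorm U.inverse (z - v) ≤ metricNorm U.inverse z :=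
    (pow_le_pow_iff_left₀ (metricNorm_nonneg _ _) (metricNorm_nonneg _ _) two_ne_zero).1
      (by linarith)
  have hg_le : metricNorm U.inverse g ≤ √G := Real.le_sqrt_of_sq_le <|
    (metricNorm_inverse_sq_le_mul_fbGap hα hU hγ.le hκ hγU hzd hzv).trans
      (mul_le_of_le_one_left hG hκ')
  calc κ * (1 - κ) * ⟪U.inverse v, v⟫_ℝ
      ≤ (1 - κ) * G - 2 * ⟪U.inverse (z - v), g⟫_ℝ :=
        mul_inner_inverse_le_mul_fbGap_sub hα hU hzv
    _ ≤ √G * √G + 2 * (metricNorm U.inverse (z - v) * metricNorm U.inverse g) := by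
      rw [Real.mul_self_sqrt hG]
      linarith [mul_nonneg hκ hG, neg_le_of_abs_le (abs_inner_map_le hW (z - v) g)]
    _ ≤ metricNorm U.inverse z * √G + 2 * (metricNorm U.inverse z * √G) := by
      gcongr <;> exact metricNorm_nonneg _ _
    _ = 3 * metricNorm U.inverse z * √G := by ring

end Gap

section QuasiFejer

theorem tendsto_and_summable_of_le_sub_add {u δ e : ℕ → ℝ} (hu : ∀ n, 0 ≤ u n)
    (hδ : ∀ n, 0 ≤ δ n) (he : Summable e) (h : ∀ n, u (n + 1) ≤ u n - δ n + e n) :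
    (∃ l, Tendsto u atTop (𝓝 l)) ∧ Summable δ := by
  have hsum_e := he.hasSum.tendsto_sum_nat
  have hsum_le (n : ℕ) :
      ∑ i ∈ Finset.range n, δ i ≤ u 0 - u n + ∑ i ∈ Finset.range n, e i := by
    rw [← Finset.sum_range_sub', ← Finset.sum_add_distrib]
    exact Finset.sum_le_sum fun i _ => by linarith [h i]
  have hδ_sum : Summable δ := by
    obtain ⟨c, hc⟩ := hsum_e.bddAbove_range
    exact summable_of_sum_range_le (c := u 0 + c) hδ fun n => by
      linarith [hsum_le n, hu n, hc ⟨n, rfl⟩]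
  set w : ℕ → ℝ := fun n => u n + ∑ i ∈ Finset.range n, (δ i - e i)
  have hw_anti : Antitone w := antitone_nat_of_succ_le fun n => by
    simp only [w, Finset.sum_range_succ]
    linarith [h n]
  have hsum := (hδ_sum.sub he).hasSum.tendsto_sum_nat
  have hw_bdd : BddBelow (Set.range w) := by
    obtain ⟨c, hc⟩ := hsum.bddBelow_range
    refine ⟨c, ?_⟩
    rintro _ ⟨n, rfl⟩
    linarith [hu n, hc ⟨n, rfl⟩]
  have hlim := (tendsto_atTop_ciInf hw_anti hw_bdd).sub hsum
  simp only [w, add_sub_cancel_right] at hlim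
  exact ⟨⟨_, hlim⟩, hδ_sum⟩

theorem tendsto_and_summable_of_le_one_add_mul {u δ η e : ℕ → ℝ} (hu : ∀ n, 0 ≤ u n)
    (hδ : ∀ n, 0 ≤ δ n) (hη : ∀ n, 0 ≤ η n) (hη_sum : Summable η) (he : ∀ n, 0 ≤ e n)
    (he_sum : Summable e) (h : ∀ n, u (n + 1) ≤ (1 + η n) * (u n - δ n + e n)) :
    (∃ l, Tendsto u atTop (𝓝 l)) ∧ Summable δ := by
  set P : ℕ → ℝ := fun n => ∏ i ∈ Finset.range n, (1 + η i)
  have hP_one (n : ℕ) : 1 ≤ P n := Finset.one_le_prod fun i _ => le_add_of_nonneg_right (hη i)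
  have hP_pos (n : ℕ) : 0 < P n := one_pos.trans_le (hP_one n)
  have hP_succ (n : ℕ) : P (n + 1) = P n * (1 + η n) := Finset.prod_range_succ _ n
  have hP_lim := (Real.multipliable_one_add_of_summable hη_sum).hasProd.tendsto_prod_nat
  obtain ⟨c, hc⟩ := hP_lim.bddAbove_range
  have hscaled (n : ℕ) : u (n + 1) / P (n + 1) ≤ u n / P n - δ n / P n + e n / P n := by
    rw [← sub_div, ← add_div, div_le_div_iff₀ (hP_pos _) (hP_pos _), hP_succ]
    calc u (n + 1) * P n ≤ (1 + η n) * (u n - δ n + e n) * P n := by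
          gcongr
          exacts [(hP_pos n).le, h n]
      _ = (u n - δ n + e n) * (P n * (1 + η n)) := by ring
  have he_scaled : Summable fun n => e n / P n :=
    he_sum.of_nonneg_of_le (fun n => div_nonneg (he n) (hP_pos n).le)
      fun n => div_le_self (he n) (hP_one n)
  obtain ⟨⟨l, hl⟩, hδ_scaled⟩ := tendsto_and_summable_of_le_sub_add
    (fun n => div_nonneg (hu n) (hP_pos n).le) (fun n => div_nonneg (hδ n) (hP_pos n).le)
    he_scaled hscaled
  refine ⟨⟨_, (hl.mul hP_lim).congr fun n => div_mul_cancel₀ _ (hP_pos n).ne'⟩, ?_⟩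
  refine (hδ_scaled.mul_left c).of_nonneg_of_le hδ fun n => ?_
  rw [← mul_div_assoc, le_div_iff₀ (hP_pos n), mul_comm]
  exact mul_le_mul_of_nonneg_right (hc ⟨n, rfl⟩) (hδ n)

theorem tendsto_and_summable_of_sq_le {q t δ η e : ℕ → ℝ} (hq : ∀ n, 0 ≤ q n)
    (hδ : ∀ n, 0 ≤ δ n) (hη : ∀ n, 0 ≤ η n) (hη_sum : Summable η) (he : ∀ n, 0 ≤ e n)
    (he_sum : Summable e) (ht : ∀ n, t n ^ 2 ≤ q n ^ 2 - δ n)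
    (h : ∀ n, q (n + 1) ^ 2 ≤ (1 + η n) * (t n + e n) ^ 2) :
    (∃ l, Tendsto q atTop (𝓝 l)) ∧ Summable δ := by
  have hstep (n : ℕ) :
      q (n + 1) ^ 2 ≤ (1 + (η n + e n + η n * e n)) * (q n ^ 2 - δ n + e n) := by
    have hη' : 0 ≤ 1 + η n := by linarith [hη n]
    have hsq : (t n + e n) ^ 2 ≤ (1 + e n) * (t n ^ 2 + e n) := by
      linarith [mul_nonneg (he n) (sq_nonneg (t n - 1))]
    calc q (n + 1) ^ 2 ≤ (1 + η n) * (t n + e n) ^ 2 := h n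
      _ ≤ (1 + η n) * ((1 + e n) * (t n ^ 2 + e n)) := by gcongr
      _ ≤ (1 + η n) * ((1 + e n) * (q n ^ 2 - δ n + e n)) := by
        have := he n
        gcongr
        exact ht n
      _ = (1 + (η n + e n + η n * e n)) * (q n ^ 2 - δ n + e n) := by ring
  have hηe_sum : Summable fun n => η n * e n :=
    (hη_sum.mul_right (∑' n, e n)).of_nonneg_of_le (fun n => mul_nonneg (hη n) (he n)) fun n =>
      mul_le_mul_of_nonneg_left (he_sum.le_tsum n fun j _ => he j) (hη n)
  obtain ⟨⟨l, hl⟩, hδ_sum⟩ := tendsto_and_summable_of_le_one_add_mul (fun n => sq_nonneg (q n)) hδ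
    (fun n => add_nonneg (add_nonneg (hη n) (he n)) (mul_nonneg (hη n) (he n)))
    ((hη_sum.add he_sum).add hηe_sum) he he_sum hstep
  exact ⟨⟨√l, hl.sqrt.congr fun n => Real.sqrt_sq (hq n)⟩, hδ_sum⟩

end QuasiFejer

section PointwiseSummable

theorem sum_Ico_le_tsum_nat_add {f : ℕ → ℝ} (hf : Summable f) (hf₀ : ∀ k, 0 ≤ f k) (N M : ℕ) :
    ∑ k ∈ Finset.Ico N M, f k ≤ ∑' k, f (k + N) := by
  simp only [Finset.sum_Ico_eq_sum_range, add_comm N]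
  exact ((summable_nat_add_iff N).2 hf).sum_le_tsum _ fun k _ => hf₀ _

theorem eventually_sum_Ico_le_of_summable {f : ℕ → ℝ} (hf : Summable f) (hf₀ : ∀ k, 0 ≤ f k)
    {ε : ℝ} (hε : 0 < ε) : ∀ᶠ N in atTop, ∀ M, ∑ k ∈ Finset.Ico N M, f k ≤ ε := by
  filter_upwards [(tendsto_sum_nat_add f).eventually_le_const hε] with N hN M
  exact (sum_Ico_le_tsum_nat_add hf hf₀ N M).trans hN

variable {H F : Type*} [NormedAddCommGroup H] [NormedAddCommGroup F] [NormedSpace ℝ F]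

theorem exists_tsum_norm_le_of_summable [NormedSpace ℝ H] [CompleteSpace H] {D : ℕ → H →L[ℝ] F}
    (hD : ∀ x, Summable fun k => ‖D k x‖) : ∃ C, ∀ x, ∑' k, ‖D k x‖ ≤ C * ‖x‖ := by
  let p : Seminorm ℝ H := Seminorm.of (fun x => ∑' k, ‖D k x‖)
    (fun x y => by
      rw [← (hD x).tsum_add (hD y)]
      refine (hD _).tsum_le_tsum (fun k => ?_) ((hD x).add (hD y))
      rw [map_add]
      exact norm_add_le _ _)
    (fun c x => by simp only [map_smul, norm_smul, tsum_mul_left])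
  have hlsc : LowerSemicontinuous p := fun x y hy => by
    obtain ⟨n, hn⟩ := ((hD x).hasSum.tendsto_sum_nat.eventually_const_lt hy).exists
    have hcont : Continuous fun z => ∑ k ∈ Finset.range n, ‖D k z‖ := by fun_prop
    filter_upwards [hcont.continuousAt.eventually_const_lt hn] with z hz
    exact hz.trans_le ((hD z).sum_le_tsum _ fun k _ => norm_nonneg _)
  obtain ⟨C, -, hC⟩ := p.bound_of_continuous_normedSpace (p.continuous_of_lowerSemicontinuous hlsc)
  exact ⟨C, hC⟩

theorem two_mul_sum_add_tsum_le [NormedSpace ℝ H] {D : ℕ → H →L[ℝ] F}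
    (hD : ∀ x, Summable fun k => ‖D k x‖) (N : ℕ) (y x : H) :
    2 * (∑ k ∈ Finset.range N, ‖D k y‖ + ∑' k, ‖D (k + N) x‖) ≤
      ∑' k, ‖D k (y + x)‖ + ∑' k, ‖D k (y - x)‖ := by
  have hy (k : ℕ) : 2 * ‖D k y‖ ≤ ‖D k (y + x)‖ + ‖D k (y - x)‖ := by
    simpa [← two_smul ℝ, norm_smul] using norm_add_le (D k y + D k x) (D k y - D k x)
  have hx (k : ℕ) : 2 * ‖D k x‖ ≤ ‖D k (y + x)‖ + ‖D k (y - x)‖ := by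
    simpa [← two_smul ℝ, norm_smul] using norm_sub_le (D k y + D k x) (D k y - D k x)
  have hsum := (hD (y + x)).add (hD (y - x))
  rw [← (hD _).tsum_add (hD _), ← hsum.sum_add_tsum_nat_add N, mul_add, Finset.mul_sum,
    ← tsum_mul_left]
  gcongr with k _ k
  · exact hy k
  · exact ((summable_nat_add_iff N).2 (hD x)).mul_left 2
  · exact (summable_nat_add_iff N).2 hsum
  · exact hx _

variable [InnerProductSpace ℝ H] [CompleteSpace H]

theorem eventually_tsum_norm_le_of_norm_eq_one {D : ℕ → H →L[ℝ] F}
    (hD : ∀ x, Summable fun k => ‖D k x‖) {ε : ℝ} (hε : 0 < ε) :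
    ∀ᶠ N in atTop, ∀ x, ‖x‖ = 1 → ∑' k, ‖D (k + N) x‖ ≤ ε := by
  obtain ⟨C, hC⟩ := exists_tsum_norm_le_of_summable hD
  -- A unit vector with a long tail would move a near-maximiser of `J` past the supremum.
  set J : H → ℝ := fun x => 4 / ε * ∑' k, ‖D k x‖ - ‖x‖ ^ 2 with hJ
  have hJ_bdd : BddAbove (Set.range J) := by
    refine ⟨(2 * C / ε) ^ 2, ?_⟩
    rintro _ ⟨x, rfl⟩
    calc J x ≤ 4 / ε * (C * ‖x‖) - ‖x‖ ^ 2 := by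
          simp only [hJ]
          gcongr
          exact hC x
      _ = (2 * C / ε) ^ 2 - (2 * C / ε - ‖x‖) ^ 2 := by ring
      _ ≤ (2 * C / ε) ^ 2 := by linarith [sq_nonneg (2 * C / ε - ‖x‖)]
  set S := ⨆ x, J x
  obtain ⟨y, hy⟩ := exists_lt_of_lt_ciSup (sub_one_lt S)
  filter_upwards [(tendsto_sum_nat_add fun k => ‖D k y‖).eventually_le_const (half_pos hε)]
    with N hN x hx
  have hsum := mul_le_mul_of_nonneg_left (two_mul_sum_add_tsum_le hD N y x)
    (by positivity : 0 ≤ 4 / ε)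
  have hsplit := (hD y).sum_add_tsum_nat_add N
  have hpar := parallelogram_law_with_norm ℝ y x
  rw [hx] at hpar
  have hgain : 4 / ε * (∑' k, ‖D (k + N) x‖ - ∑' k, ‖D (k + N) y‖) < 2 := by
    have hadd : J (y + x) ≤ S := le_ciSup hJ_bdd _
    have hsub : J (y - x) ≤ S := le_ciSup hJ_bdd _
    simp only [hJ, ← hsplit] at hy hadd hsub
    linarith
  rw [div_mul_eq_mul_div, div_lt_iff₀ hε] at hgain
  linarith

theorem eventually_sum_Ico_norm_le {D : ℕ → H →L[ℝ] F} (hD : ∀ x, Summable fun k => ‖D k x‖)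
    {ε : ℝ} (hε : 0 < ε) :
    ∀ᶠ N in atTop, ∀ M x, ∑ k ∈ Finset.Ico N M, ‖D k x‖ ≤ ε * ‖x‖ := by
  filter_upwards [eventually_tsum_norm_le_of_norm_eq_one hD hε] with N hN M x
  refine (sum_Ico_le_tsum_nat_add (hD x) (fun k => norm_nonneg _) N M).trans ?_
  rcases eq_or_ne x 0 with rfl | hx
  · simp
  · have hunit := hN (‖x‖⁻¹ • x) (norm_smul_inv_norm hx)
    simp only [map_smul, norm_smul, norm_inv, norm_norm, tsum_mul_left] at hunit
    rwa [inv_mul_le_iff₀ (norm_pos_iff.2 hx), mul_comm] at hunit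

end PointwiseSummable

section Variation

variable {H F : Type*} [NormedAddCommGroup H] [NormedAddCommGroup F] [NormedSpace ℝ F]

theorem sum_Ico_norm_apply_le [NormedSpace ℝ H] {D : ℕ → H →L[ℝ] F} {δ : ℝ} {N M : ℕ}
    (hD : ∀ x, ∑ k ∈ Finset.Ico N M, ‖D k x‖ ≤ δ * ‖x‖) (v : ℕ → H) :
    ∑ k ∈ Finset.Ico N M, ‖D k (v k)‖ ≤
      δ * (‖v N‖ + ∑ j ∈ Finset.Ico N M, ‖v (j + 1) - v j‖) := by
  have hterm : ∀ k ∈ Finset.Ico N M, ‖D k (v k)‖ ≤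
      ‖D k (v N)‖ + ∑ j ∈ Finset.Ico N M, ‖D k (v (j + 1) - v j)‖ := fun k hk => by
    obtain ⟨hNk, hkM⟩ := Finset.mem_Ico.1 hk
    have htelescope : v k = v N + ∑ j ∈ Finset.Ico N k, (v (j + 1) - v j) := by
      rw [Finset.sum_Ico_sub v hNk, add_sub_cancel]
    calc ‖D k (v k)‖ = ‖D k (v N) + ∑ j ∈ Finset.Ico N k, D k (v (j + 1) - v j)‖ := by
          rw [← map_sum, ← map_add, ← htelescope]
      _ ≤ ‖D k (v N)‖ + ∑ j ∈ Finset.Ico N k, ‖D k (v (j + 1) - v j)‖ :=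
          norm_add_le_of_le le_rfl (norm_sum_le _ _)
      _ ≤ ‖D k (v N)‖ + ∑ j ∈ Finset.Ico N M, ‖D k (v (j + 1) - v j)‖ := by gcongr
  calc ∑ k ∈ Finset.Ico N M, ‖D k (v k)‖
      ≤ ∑ k ∈ Finset.Ico N M, ‖D k (v N)‖ +
          ∑ j ∈ Finset.Ico N M, ∑ k ∈ Finset.Ico N M, ‖D k (v (j + 1) - v j)‖ := by
        rw [Finset.sum_comm, ← Finset.sum_add_distrib]
        exact Finset.sum_le_sum hterm
    _ ≤ δ * ‖v N‖ + ∑ j ∈ Finset.Ico N M, δ * ‖v (j + 1) - v j‖ := by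
        gcongr <;> exact hD _
    _ = δ * (‖v N‖ + ∑ j ∈ Finset.Ico N M, ‖v (j + 1) - v j‖) := by rw [mul_add, Finset.mul_sum]

theorem eventually_norm_le_two_mul_add_sum [InnerProductSpace ℝ H] [CompleteSpace H]
    {D : ℕ → H →L[ℝ] F} (hD : ∀ x, Summable fun k => ‖D k x‖) {v : ℕ → H} {s : ℕ → ℝ} {c : ℝ}
    (hc : 0 < c) (hv : ∀ k, ‖v (k + 1) - v k‖ ≤ s k + c * ‖D k (v k)‖) :
    ∀ᶠ N in atTop, ∀ M, N ≤ M → ‖v M‖ ≤ 2 * ‖v N‖ + 2 * ∑ k ∈ Finset.Ico N M, s k := by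
  filter_upwards [eventually_sum_Ico_norm_le hD (by positivity : 0 < (2 * c)⁻¹)] with N hN M hNM
  set V := ∑ k ∈ Finset.Ico N M, ‖v (k + 1) - v k‖
  have hV : V ≤ ∑ k ∈ Finset.Ico N M, s k + (‖v N‖ + V) / 2 :=
    calc V ≤ ∑ k ∈ Finset.Ico N M, (s k + c * ‖D k (v k)‖) := Finset.sum_le_sum fun k _ => hv k
      _ = ∑ k ∈ Finset.Ico N M, s k + c * ∑ k ∈ Finset.Ico N M, ‖D k (v k)‖ := by
          rw [Finset.sum_add_distrib, Finset.mul_sum]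
      _ ≤ ∑ k ∈ Finset.Ico N M, s k + c * ((2 * c)⁻¹ * (‖v N‖ + V)) := by
          gcongr
          exact sum_Ico_norm_apply_le (hN M) v
      _ = ∑ k ∈ Finset.Ico N M, s k + (‖v N‖ + V) / 2 := by field_simp
  have hvM : ‖v M - v N‖ ≤ V := by
    rw [← Finset.sum_Ico_sub v hNM]
    exact norm_sum_le _ _
  linarith [norm_sub_norm_le (v M) (v N)]

end Variation

section Excursion

variable {r lam s : ℕ → ℝ} {ρ C L : ℝ} {p : ℕ}

theorem frequently_lt_of_summable_mul_pow (hlam : ∀ k, 0 ≤ lam k) (hdiv : ¬Summable lam)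
    (hsum : Summable fun k => lam k * r k ^ p) (hρ : 0 < ρ) : ∃ᶠ k in atTop, r k < ρ := by
  intro hcon
  refine hdiv ((hsum.mul_left (ρ ^ p)⁻¹).of_norm_bounded_eventually_nat ?_)
  filter_upwards [hcon] with k hk
  rw [Real.norm_of_nonneg (hlam k), ← div_eq_inv_mul, le_div_iff₀ (by positivity)]
  exact mul_le_mul_of_nonneg_left (pow_le_pow_left₀ hρ.le (not_lt.1 hk) p) (hlam k)

theorem exists_last_lt {N₀ M : ℕ} (hN₀ : N₀ ≤ M) (hr : r N₀ < ρ) :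
    ∃ N, N₀ ≤ N ∧ N ≤ M ∧ r N < ρ ∧ ∀ k, N < k → k ≤ M → ρ ≤ r k := by
  classical
  refine ⟨Nat.findGreatest (fun k => r k < ρ) M, Nat.le_findGreatest hN₀ hr,
    Nat.findGreatest_le M, Nat.findGreatest_spec (P := fun k => r k < ρ) hN₀ hr, ?_⟩
  exact fun k hNk hkM => not_lt.1 (Nat.findGreatest_is_greatest hNk hkM)

theorem sum_excursion_le {N M : ℕ} (hr : ∀ k, 0 ≤ r k) (hlam : ∀ k, 0 ≤ lam k) (hL : lam N ≤ L)
    (hρ : 0 < ρ) (hN : r N ≤ ρ) (hout : ∀ k, N < k → k ≤ M → ρ ≤ r k)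
    (hsum : ∑ k ∈ Finset.Ico (N + 1) M, lam k * r k ^ (p + 1) ≤ ρ ^ (p + 1)) :
    ∑ k ∈ Finset.Ico N M, lam k * r k ≤ (L + 1) * ρ := by
  have hL₀ : 0 ≤ L := (hlam N).trans hL
  rcases le_or_gt M N with hMN | hNM
  · rw [Finset.Ico_eq_empty_of_le hMN, Finset.sum_empty]
    positivity
  have hterm : ∀ k ∈ Finset.Ico (N + 1) M, lam k * r k ≤ (ρ ^ p)⁻¹ * (lam k * r k ^ (p + 1)) := by
    intro k hk
    obtain ⟨hNk, hkM⟩ := Finset.mem_Ico.1 hk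
    rw [← div_eq_inv_mul, le_div_iff₀ (by positivity), pow_succ', ← mul_assoc]
    exact mul_le_mul_of_nonneg_left (pow_le_pow_left₀ hρ.le (hout k hNk hkM.le) p)
      (mul_nonneg (hlam k) (hr k))
  calc ∑ k ∈ Finset.Ico N M, lam k * r k
      = lam N * r N + ∑ k ∈ Finset.Ico (N + 1) M, lam k * r k :=
        Finset.sum_eq_sum_Ico_succ_bot hNM _
    _ ≤ L * ρ + (ρ ^ p)⁻¹ * ∑ k ∈ Finset.Ico (N + 1) M, lam k * r k ^ (p + 1) := by
        rw [Finset.mul_sum]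
        exact add_le_add (mul_le_mul hL hN (hr N) hL₀) (Finset.sum_le_sum hterm)
    _ ≤ L * ρ + (ρ ^ p)⁻¹ * ρ ^ (p + 1) := by gcongr
    _ = (L + 1) * ρ := by
        rw [pow_succ']
        field_simp

/-- Off the sublevel set `{r < ρ}`, to which `r` keeps returning, the growth of `r` is paid for by
the summable `lam * r ^ (p + 1)`. -/
theorem tendsto_zero_of_eventually_le_two_mul_add_sum (hr : ∀ k, 0 ≤ r k)
    (hlam : ∀ k, 0 ≤ lam k) (hL : ∀ k, lam k ≤ L) (hdiv : ¬Summable lam)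
    (hsum : Summable fun k => lam k * r k ^ (p + 1)) (hs : Summable s) (hs₀ : ∀ k, 0 ≤ s k)
    (hC : 0 ≤ C) (hgrow : ∀ᶠ N in atTop, ∀ M, N ≤ M →
      r M ≤ 2 * r N + 2 * ∑ k ∈ Finset.Ico N M, (C * (lam k * r k) + s k)) :
    Tendsto r atTop (𝓝 0) := by
  refine Metric.tendsto_atTop.2 fun ε hε => ?_
  have hL₀ : 0 ≤ L := (hlam 0).trans (hL 0)
  obtain ⟨ρ, hρ, hρε⟩ : ∃ ρ > 0, (4 + 2 * C * (L + 1)) * ρ = ε :=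
    ⟨ε / (4 + 2 * C * (L + 1)), by positivity, by field_simp⟩
  obtain ⟨N₀, hgood⟩ := eventually_atTop.1 <| hgrow.and <|
    (eventually_sum_Ico_le_of_summable hs hs₀ hρ).and <|
    eventually_sum_Ico_le_of_summable hsum (fun k => mul_nonneg (hlam k) (pow_nonneg (hr k) _))
      (pow_pos hρ (p + 1))
  obtain ⟨N₁, hN₁, hrN₁⟩ :=
    (frequently_atTop.1 (frequently_lt_of_summable_mul_pow hlam hdiv hsum hρ)) N₀
  refine ⟨N₁, fun M hM => ?_⟩
  obtain ⟨N, hN, hNM, hrN, hout⟩ := exists_last_lt hM hrN₁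
  obtain ⟨hgrowN, hsN, -⟩ := hgood N (hN₁.trans hN)
  obtain ⟨-, -, hsumN⟩ := hgood (N + 1) (hN₁.trans (hN.trans N.le_succ))
  have hexc := sum_excursion_le hr hlam (hL N) hρ hrN.le hout (hsumN M)
  have hsum_le := mul_le_mul_of_nonneg_left hexc hC
  have hrM := hgrowN M hNM
  rw [Finset.sum_add_distrib, ← Finset.mul_sum] at hrM
  rw [Real.dist_0_eq_abs, abs_of_nonneg (hr M)]
  linarith [hsN M]

end Excursion

section WeakConvergence

variable {H ι : Type*} [NormedAddCommGroup H] [InnerProductSpace ℝ H] {F : Filter ι}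
  {x p u : ι → H} {R : ℝ} {z p₀ u₀ : H}

/-- Weak convergence `x k ⇀ z` along the filter `F`, tested against inner products. -/
def WeaklyTendsto (x : ι → H) (F : Filter ι) (z : H) : Prop :=
  ∀ y, Tendsto (fun k => ⟪x k, y⟫_ℝ) F (𝓝 ⟪z, y⟫_ℝ)

theorem tendsto_toWeakSpace_iff [CompleteSpace H] :
    Tendsto (fun k => toWeakSpace ℝ H (x k)) F (𝓝 (toWeakSpace ℝ H z)) ↔
      WeaklyTendsto x F z := by
  have hinj : Function.Injective (topDualPairing ℝ H).flip := fun y w hyw => by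
    refine ext_inner_left ℝ fun q => ?_
    simpa using DFunLike.congr_fun hyw (InnerProductSpace.toDual ℝ H q)
  refine (WeakBilin.tendsto_iff_forall_eval_tendsto (topDualPairing ℝ H).flip hinj).trans
    ((InnerProductSpace.toDual ℝ H).surjective.forall.trans (forall_congr' fun y => ?_))
  simp only [real_inner_comm y]
  rfl

theorem exists_weaklyTendsto_ultrafilter [CompleteSpace H] (hx : ∀ k, ‖x k‖ ≤ R)
    (F : Ultrafilter ι) : ∃ z, WeaklyTendsto x F z := by
  let f : ι → WeakDual ℝ H := fun k => StrongDual.toWeakDual (InnerProductSpace.toDual ℝ H (x k))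
  have hf (k : ι) : f k ∈ WeakDual.toStrongDual ⁻¹' Metric.closedBall (0 : StrongDual ℝ H) R := by
    rw [Set.mem_preimage, mem_closedBall_zero_iff]
    exact ((InnerProductSpace.toDual ℝ H).norm_map (x k)).trans_le (hx k)
  obtain ⟨g, -, hg⟩ := (WeakDual.isCompact_closedBall (𝕜 := ℝ) (E := H) 0 R).ultrafilter_le_nhds
    (F.map f) (le_principal_iff.2 (mem_map.2 (univ_mem' hf)))
  refine ⟨(InnerProductSpace.toDual ℝ H).symm (WeakDual.toStrongDual g), fun y => ?_⟩
  rw [InnerProductSpace.toDual_symm_apply]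
  exact ((WeakDual.eval_continuous y).tendsto g).comp hg

theorem WeaklyTendsto.mono {G : Filter ι} (hx : WeaklyTendsto x F z) (hG : G ≤ F) :
    WeaklyTendsto x G z := fun y => (hx y).mono_left hG

theorem WeaklyTendsto.sub_of_tendsto (hx : WeaklyTendsto x F z) (hp : Tendsto p F (𝓝 p₀)) :
    WeaklyTendsto (fun k => x k - p k) F (z - p₀) := fun y => by
  simpa only [inner_sub_left] using (hx y).sub (hp.inner tendsto_const_nhds)

theorem WeaklyTendsto.inner (hp : WeaklyTendsto p F p₀) (hR : ∀ k, ‖p k‖ ≤ R)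
    (hu : Tendsto u F (𝓝 u₀)) : Tendsto (fun k => ⟪p k, u k⟫_ℝ) F (𝓝 ⟪p₀, u₀⟫_ℝ) := by
  have hsmall : Tendsto (fun k => ⟪p k, u k - u₀⟫_ℝ) F (𝓝 0) := by
    refine squeeze_zero_norm (a := fun k => R * ‖u k - u₀‖) (fun k => ?_) ?_
    · exact (norm_inner_le_norm _ _).trans (mul_le_mul_of_nonneg_right (hR k) (norm_nonneg _))
    · simpa using (tendsto_iff_norm_sub_tendsto_zero.1 hu).const_mul R
  simpa [← inner_add_right] using hsmall.add (hp u₀)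

theorem exists_weaklyTendsto_of_unique [CompleteSpace H] [F.NeBot] (hx : ∀ k, ‖x k‖ ≤ R)
    (huniq : ∀ G G' : Ultrafilter ι, ↑G ≤ F → ↑G' ≤ F → ∀ z z', WeaklyTendsto x G z →
      WeaklyTendsto x G' z' → z = z') : ∃ z, WeaklyTendsto x F z := by
  obtain ⟨z, hz⟩ := exists_weaklyTendsto_ultrafilter hx (Ultrafilter.of F)
  refine ⟨z, fun y => tendsto_iff_ultrafilter _ _ _ |>.2 fun G hG => ?_⟩
  obtain ⟨z', hz'⟩ := exists_weaklyTendsto_ultrafilter hx G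
  rw [huniq _ G (Ultrafilter.of_le F) hG z z' hz hz']
  exact hz' y

theorem IsMaximalMonotone.mem_of_weaklyTendsto [F.NeBot] {A : H → Set H}
    (hA : IsMaximalMonotone A) (hp : WeaklyTendsto p F p₀) (hR : ∀ k, ‖p k‖ ≤ R)
    (hu : Tendsto u F (𝓝 u₀)) (hmem : ∀ k, u k ∈ A (p k)) : u₀ ∈ A p₀ := by
  refine hA.mem_of_forall fun q w hw => ?_
  have hlim := (hp.sub_of_tendsto (tendsto_const_nhds (x := q))).inner (R := R + ‖q‖)
    (fun k => norm_sub_le_of_le (hR k) le_rfl) (hu.sub_const w)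
  exact ge_of_tendsto' hlim fun k => hA.1 _ _ _ (hmem k) _ hw

theorem IsCocoercive.eq_of_weaklyTendsto [F.NeBot] {β : ℝ} {B : H → H} (hB : IsCocoercive β B)
    (hβ : 0 < β) (hx : WeaklyTendsto x F z) (hR : ∀ k, ‖x k‖ ≤ R)
    (hBx : Tendsto (fun k => B (x k)) F (𝓝 u₀)) : B z = u₀ := by
  have hinner := (hx.sub_of_tendsto (tendsto_const_nhds (x := z))).inner (R := R + ‖z‖)
    (fun k => norm_sub_le_of_le (hR k) le_rfl) (hBx.sub_const (B z))
  have hle := le_of_tendsto_of_tendsto' (((hBx.sub_const (B z)).norm.pow 2).const_mul β) hinner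
    fun k => hB (x k) z
  rw [sub_self, inner_zero_left] at hle
  exact (sub_eq_zero.1 (norm_eq_zero.1 (pow_eq_zero_iff two_ne_zero |>.1
    (le_antisymm (nonpos_of_mul_nonpos_right hle hβ) (sq_nonneg _))))).symm

end WeakConvergence

section Opial

variable {H ι : Type*} [NormedAddCommGroup H] [InnerProductSpace ℝ H]
  {F : Filter ι} {x : ι → H} {W : ι → H →L[ℝ] H} {R c : ℝ} {z z' w w' : H}

theorem exists_tendsto_inner_of_tendsto_metricNorm (hW : ∀ k, (W k).IsPositive)
    (hw : Tendsto (fun k => W k z) F (𝓝 w)) (hw' : Tendsto (fun k => W k z') F (𝓝 w')) {l l' : ℝ}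
    (hl : Tendsto (fun k => metricNorm (W k) (x k - z)) F (𝓝 l))
    (hl' : Tendsto (fun k => metricNorm (W k) (x k - z')) F (𝓝 l')) :
    ∃ r, Tendsto (fun k => ⟪x k, W k (z - z')⟫_ℝ) F (𝓝 r) := by
  have hlim := (((hl'.pow 2).sub (hl.pow 2)).add ((hw.inner (tendsto_const_nhds (x := z))).sub
    (hw'.inner (tendsto_const_nhds (x := z'))))).div_const 2
  refine ⟨_, hlim.congr fun k => ?_⟩
  rw [metricNorm_sq (hW k), metricNorm_sq (hW k), inner_map_sub_sub (hW k),
    inner_map_sub_sub (hW k), map_sub, inner_sub_right, ← (hW k).inner_left_eq_inner_right,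
    ← (hW k).inner_left_eq_inner_right]
  ring

theorem eq_of_tendsto_inner_of_weaklyTendsto {G G' : Filter ι} [G.NeBot] [G'.NeBot] (hG : G ≤ F)
    (hG' : G' ≤ F) (hx : ∀ k, ‖x k‖ ≤ R) (hc : 0 < c) (hWc : ∀ k y, c * ‖y‖ ^ 2 ≤ ⟪W k y, y⟫_ℝ)
    (hw : Tendsto (fun k => W k (z - z')) F (𝓝 w)) {r : ℝ}
    (hr : Tendsto (fun k => ⟪x k, W k (z - z')⟫_ℝ) F (𝓝 r)) (hz : WeaklyTendsto x G z)
    (hz' : WeaklyTendsto x G' z') : z = z' := by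
  have hzw := tendsto_nhds_unique (hz.inner hx (hw.mono_left hG)) (hr.mono_left hG)
  have hzw' := tendsto_nhds_unique (hz'.inner hx (hw.mono_left hG')) (hr.mono_left hG')
  have hcoer : c * ‖z - z'‖ ^ 2 ≤ ⟪w, z - z'⟫_ℝ :=
    ge_of_tendsto' ((hw.mono_left hG).inner tendsto_const_nhds) fun k => hWc k _
  rw [real_inner_comm, inner_sub_left, hzw, hzw', sub_self] at hcoer
  exact sub_eq_zero.1 (norm_eq_zero.1 (pow_eq_zero_iff two_ne_zero |>.1
    (le_antisymm (nonpos_of_mul_nonpos_right hcoer hc) (sq_nonneg _))))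

/-- Opial's lemma in a variable metric. -/
theorem exists_weaklyTendsto_of_tendsto_metricNorm [CompleteSpace H] [F.NeBot]
    (hx : ∀ k, ‖x k‖ ≤ R) (hW : ∀ k, (W k).IsPositive) (hc : 0 < c)
    (hWc : ∀ k y, c * ‖y‖ ^ 2 ≤ ⟪W k y, y⟫_ℝ)
    (hWlim : ∀ y, ∃ w, Tendsto (fun k => W k y) F (𝓝 w)) {S : Set H}
    (hS : ∀ y ∈ S, ∃ l, Tendsto (fun k => metricNorm (W k) (x k - y)) F (𝓝 l))
    (hcluster : ∀ G : Ultrafilter ι, ↑G ≤ F → ∀ y, WeaklyTendsto x G y → y ∈ S) :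
    ∃ y ∈ S, WeaklyTendsto x F y := by
  obtain ⟨y, hy⟩ := exists_weaklyTendsto_of_unique (F := F) hx fun G G' hG hG' z z' hz hz' => by
    obtain ⟨l, hl⟩ := hS z (hcluster G hG z hz)
    obtain ⟨l', hl'⟩ := hS z' (hcluster G' hG' z' hz')
    obtain ⟨w, hw⟩ := hWlim z
    obtain ⟨w', hw'⟩ := hWlim z'
    obtain ⟨v, hv⟩ := hWlim (z - z')
    obtain ⟨r, hr⟩ := exists_tendsto_inner_of_tendsto_metricNorm hW hw hw' hl hl'
    exact eq_of_tendsto_inner_of_weaklyTendsto hG hG' hx hc hWc hv hr hz hz'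
  exact ⟨y, hcluster _ (Ultrafilter.of_le F) y (hy.mono (Ultrafilter.of_le F)), hy⟩

end Opial

section Coercivity

variable {H : Type*} [NormedAddCommGroup H] [InnerProductSpace ℝ H]
  {A : H → Set H} {B : H → H} {α β γ : ℝ} {U : H →L[ℝ] H}

theorem one_div_avgConst (hβ : 0 < β) (γ : ℝ) (U : H →L[ℝ] H) :
    1 / avgConst β γ U = 2 - γ * ‖U‖ / (2 * β) := by
  rw [avgConst, one_div_div]
  field_simp
  ring

variable [CompleteSpace H]

theorem sq_norm_le_mul_sqrt_fbGap (hα : 0 < α) (hβ : 0 < β) (hU : U ∈ strongPos α) {γlow ε : ℝ}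
    (hγlow : 0 < γlow) (hγ : γlow ≤ γ) (hε : 0 < ε) (hγU : γ * ‖U‖ ≤ 2 * β - ε) {z v d : H}
    (hzd : β * ‖d‖ ^ 2 ≤ ⟪z, d⟫_ℝ) (hzv : 0 ≤ ⟪z - v, U.inverse v - γ • d⟫_ℝ) :
    ‖v‖ ^ 2 ≤ 12 * β ^ 2 / (γlow * ε) * metricNorm U.inverse z *
      √(fbGap (γ * ‖U‖ / (2 * β)) U.inverse z v) := by
  have hγ_pos : 0 < γ := hγlow.trans_le hγ
  set κ := γ * ‖U‖ / (2 * β) with hκ_def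
  set G := √(fbGap κ U.inverse z v)
  have hκ_mul : γ * ‖U‖ = 2 * β * κ := by rw [hκ_def]; field_simp
  have hκ_le : ε ≤ 2 * β * (1 - κ) := by linarith
  have hκ : 0 ≤ κ := by positivity
  have hκ' : 0 ≤ 1 - κ := (pos_of_mul_pos_right (hε.trans_le hκ_le) (by positivity)).le
  have hcoer := mul_inner_inverse_le_mul_sqrt_fbGap hα hU hγ_pos hκ (by linarith) hκ_mul.le hzd hzv
  have hmain : γlow * ε * ‖v‖ ^ 2 ≤ 12 * β ^ 2 * (metricNorm U.inverse z * G) := calc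
    γlow * ε * ‖v‖ ^ 2 ≤ γ * (2 * β * (1 - κ)) * (‖U‖ * ⟪U.inverse v, v⟫_ℝ) := by
      gcongr
      exact sq_norm_le_mul_inner_inverse hα hU le_rfl v
    _ = 2 * β * (1 - κ) * (γ * ‖U‖ * ⟪U.inverse v, v⟫_ℝ) := by ring
    _ = 4 * β ^ 2 * (κ * (1 - κ) * ⟪U.inverse v, v⟫_ℝ) := by rw [hκ_mul]; ring
    _ ≤ 4 * β ^ 2 * (3 * metricNorm U.inverse z * G) := by gcongr
    _ = 12 * β ^ 2 * (metricNorm U.inverse z * G) := by ring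
  rw [mul_assoc, div_mul_eq_mul_div, le_div_iff₀' (by positivity)]
  exact hmain

theorem sq_norm_le_mul_norm_mul_norm (hα : 0 < α) (hβ : 0 < β) (hU : U ∈ strongPos α)
    (hγ : 0 < γ) {z v d : H} (hzd : β * ‖d‖ ^ 2 ≤ ⟪z, d⟫_ℝ) (hd : β * ‖d‖ ≤ ‖z‖)
    (hzv : 0 ≤ ⟪z - v, U.inverse v - γ • d⟫_ℝ) :
    β ^ 2 * ‖d‖ ^ 2 ≤ (1 + β / (α * γ)) * ‖z‖ * ‖v‖ := by
  have hvv := (isPositive_inverse_of_mem_strongPos hα hU).inner_nonneg_right v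
  have hzWv : ⟪z, U.inverse v⟫_ℝ ≤ ‖z‖ * ‖v‖ / α := by
    rw [mul_div_assoc]
    refine (real_inner_le_norm _ _).trans (mul_le_mul_of_nonneg_left ?_ (norm_nonneg _))
    rw [le_div_iff₀' hα]
    exact mul_norm_inverse_le_of_mem_strongPos hα hU v
  have hzd_le : γ * ⟪z, d⟫_ℝ ≤ ‖z‖ * ‖v‖ / α + γ * (‖v‖ * ‖d‖) := by
    have hvd := mul_le_mul_of_nonneg_left (real_inner_le_norm v d) hγ.le
    simp only [inner_sub_left, inner_sub_right, inner_smul_right] at hzv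
    linarith
  calc β ^ 2 * ‖d‖ ^ 2 = β / γ * (γ * (β * ‖d‖ ^ 2)) := by field_simp
    _ ≤ β / γ * (‖z‖ * ‖v‖ / α + γ * (‖v‖ * ‖d‖)) := by
      gcongr
      exact (mul_le_mul_of_nonneg_left hzd hγ.le).trans hzd_le
    _ = β / (α * γ) * ‖z‖ * ‖v‖ + ‖v‖ * (β * ‖d‖) := by field_simp
    _ ≤ β / (α * γ) * ‖z‖ * ‖v‖ + ‖v‖ * ‖z‖ := by gcongr
    _ = (1 + β / (α * γ)) * ‖z‖ * ‖v‖ := by ring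

theorem fbResidual_eq_zero (hA : IsMaximalMonotone A) (hα : 0 < α) (hU : U ∈ strongPos α)
    (hγ : 0 < γ) {xs : H} (hxs : xs ∈ zer (addSingle A B)) : fbResidual A B γ U xs = 0 := by
  have hinner := inner_sub_fbResidual_nonneg hA hα hU hγ xs hxs
  simp only [sub_self, smul_zero, zero_sub, sub_zero, inner_neg_left] at hinner
  rw [real_inner_comm] at hinner
  have hsq := (sq_norm_le_mul_inner_inverse hα hU le_rfl (fbResidual A B γ U xs)).trans
    (mul_nonpos_of_nonneg_of_nonpos (norm_nonneg U) (neg_nonneg.1 hinner))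
  exact norm_eq_zero.1 (pow_eq_zero_iff two_ne_zero |>.1 (le_antisymm hsq (sq_nonneg _)))

theorem metricNorm_resolvent_sub_fbOp_add_le (hA : IsMaximalMonotone A) (hα : 0 < α)
    (hU : U ∈ strongPos α) (hγ : 0 < γ) (hγU : γ * ‖U‖ ≤ 2 * β) (x a b : H) :
    metricNorm U.inverse
        (resolvent (scaledOp γ U A) (x - γ • U (B x + b)) - fbOp A B γ U x + a) ≤
      (2 * β * ‖b‖ + ‖a‖) / √α := by
  have hb : ‖x - γ • U (B x + b) - (x - γ • U (B x))‖ ≤ 2 * β * ‖b‖ := calc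
    _ = γ * ‖U b‖ := by
      rw [sub_sub_sub_cancel_left, ← smul_sub, ← map_sub, sub_add_cancel_left, map_neg, smul_neg,
        norm_neg, norm_smul, Real.norm_of_nonneg hγ.le]
    _ ≤ γ * (‖U‖ * ‖b‖) := by gcongr; exact U.le_opNorm b
    _ = γ * ‖U‖ * ‖b‖ := by ring
    _ ≤ 2 * β * ‖b‖ := by gcongr
  refine (metricNorm_add_le (isPositive_inverse_of_mem_strongPos hα hU) _ _).trans ?_
  rw [add_div]
  refine add_le_add ?_ (metricNorm_inverse_le hα hU a)
  exact (hA.metricNorm_resolvent_sub_le hα hU hγ _ _).trans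
    ((metricNorm_inverse_le hα hU _).trans (by gcongr))

theorem norm_fbResidual_sub_fbResidual_le (hA : IsMaximalMonotone A) (hB : IsCocoercive β B)
    (hα : 0 < α) (hU : U ∈ strongPos α) (hγ : 0 < γ) (hγU : γ * ‖U‖ ≤ 2 * β) {γ' : ℝ}
    {U' : H →L[ℝ] H} (hU' : U' ∈ strongPos α) (hγ' : 0 < γ') {m : ℝ} (hUm : ‖U‖ ≤ m)
    (hUm' : ‖U'‖ ≤ m) {x x' v w v' : H} (hv : fbResidual A B γ U x = v)
    (hw : fbResidual A B γ U x' = w) (hv' : fbResidual A B γ' U' x' = v') :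
    ‖v' - v‖ ≤ (1 + √m / √α) * (1 + 2 * m / α) * ‖x' - x‖ +
      m * (|γ' - γ| / γ * (‖w‖ / α)) + m * ‖U.inverse v - U'.inverse v‖ := by
  have hm : 0 ≤ m := (norm_nonneg _).trans hUm
  have hwv : ‖w - v‖ ≤ (1 + √m / √α) * ‖x' - x‖ := by
    rw [← hw, ← hv]
    exact norm_fbResidual_sub_le hA hB hα hU hγ hγU hUm x' x
  have hW {V : H →L[ℝ] H} (hV : V ∈ strongPos α) : ‖V.inverse (w - v)‖ ≤ ‖w - v‖ / α := by
    rw [le_div_iff₀' hα]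
    exact mul_norm_inverse_le_of_mem_strongPos hα hV _
  have htransfer : ‖U.inverse w - U'.inverse w‖ ≤
      ‖U.inverse v - U'.inverse v‖ + (‖w - v‖ / α + ‖w - v‖ / α) := by
    have hsplit : U.inverse w - U'.inverse w = U.inverse v - U'.inverse v +
        (U.inverse (w - v) - U'.inverse (w - v)) := by
      rw [map_sub, map_sub]
      abel
    rw [hsplit]
    exact (norm_add_le _ _).trans (add_le_add le_rfl (norm_sub_le_of_le (hW hU) (hW hU')))
  calc ‖v' - v‖ ≤ ‖v' - w‖ + ‖w - v‖ := norm_sub_le_norm_sub_add_norm_sub _ _ _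
    _ ≤ m * (|γ' - γ| / γ * (‖w‖ / α) +
        (‖U.inverse v - U'.inverse v‖ + (‖w - v‖ / α + ‖w - v‖ / α))) + ‖w - v‖ := by
      gcongr
      exact (norm_fbResidual_change_le hA hα hU hγ hU' hγ' hUm' hw hv').trans (by gcongr)
    _ = (1 + 2 * m / α) * ‖w - v‖ + m * (|γ' - γ| / γ * (‖w‖ / α)) +
        m * ‖U.inverse v - U'.inverse v‖ := by ring
    _ ≤ (1 + 2 * m / α) * ((1 + √m / √α) * ‖x' - x‖) + m * (|γ' - γ| / γ * (‖w‖ / α)) +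
        m * ‖U.inverse v - U'.inverse v‖ := by gcongr
    _ = _ := by ring

end Coercivity

section Iteration

variable {H : Type*} [NormedAddCommGroup H] [InnerProductSpace ℝ H] [CompleteSpace H]

/-- The inexact variable metric forward-backward iteration, with relaxations `lam k` in the closed
interval `[0, 1 / αₖ]`, for a maximal monotone `A` and a `β`-cocoercive `B`. The auxiliary points
`yₖ = xₖ - γₖ Uₖ (B xₖ + bₖ)` are substituted in the recursion. -/
structure IsForwardBackwardIteration (A : H → Set H) (B : H → H) (α β : ℝ) (η : ℕ → ℝ)
    (U : ℕ → H →L[ℝ] H) (γ lam : ℕ → ℝ) (a b x : ℕ → H) : Prop where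
  maximal : IsMaximalMonotone A
  beta_pos : 0 < β
  cocoercive : IsCocoercive β B
  alpha_pos : 0 < α
  eta_nonneg : ∀ k, 0 ≤ η k
  eta_summable : Summable η
  mem_strongPos : ∀ k, U k ∈ strongPos α
  le_succ : ∀ k, U k ≤ (1 + η k) • U (k + 1)
  gamma_pos : ∀ k, 0 < γ k
  gamma_le : ∀ k, γ k * ‖U k‖ ≤ 2 * β
  lam_nonneg : ∀ k, 0 ≤ lam k
  lam_le : ∀ k, lam k ≤ 1 / avgConst β (γ k) (U k)
  summable_a : Summable fun k => lam k * ‖a k‖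
  summable_b : Summable fun k => lam k * ‖b k‖
  step : ∀ k, x (k + 1) = x k + lam k •
    (resolvent (scaledOp (γ k) (U k) A) (x k - γ k • U k (B (x k) + b k)) + a k - x k)

/-- A bound for the error made in one step of the iteration, in the metric of `Uₖ⁻¹`. -/
noncomputable def stepError (α β : ℝ) (lam : ℕ → ℝ) (a b : ℕ → H) (k : ℕ) : ℝ :=
  lam k * ((2 * β * ‖b k‖ + ‖a k‖) / √α)

namespace IsForwardBackwardIteration

variable {A : H → Set H} {B : H → H} {α β m R γlow : ℝ} {η γ lam : ℕ → ℝ} {U : ℕ → H →L[ℝ] H}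
  {a b x : ℕ → H} {xs : H}

theorem lam_le_two_sub (hI : IsForwardBackwardIteration A B α β η U γ lam a b x) (k : ℕ) :
    lam k ≤ 2 - γ k * ‖U k‖ / (2 * β) :=
  (hI.lam_le k).trans_eq (one_div_avgConst hI.beta_pos _ _)

theorem lam_le_two (hI : IsForwardBackwardIteration A B α β η U γ lam a b x) (k : ℕ) :
    lam k ≤ 2 := by
  have hβ := hI.beta_pos
  have hγ := hI.gamma_pos k
  exact (hI.lam_le_two_sub k).trans (sub_le_self _ (by positivity))

theorem opNorm_le (hI : IsForwardBackwardIteration A B α β η U γ lam a b x) (hγlow : 0 < γlow)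
    (hγ : ∀ k, γlow ≤ γ k) (k : ℕ) : ‖U k‖ ≤ 2 * β / γlow := by
  rw [le_div_iff₀' hγlow]
  exact (mul_le_mul_of_nonneg_right (hγ k) (norm_nonneg _)).trans (hI.gamma_le k)

theorem not_summable_lam (hI : IsForwardBackwardIteration A B α β η U γ lam a b x)
    (hdiv : Tendsto (fun n => ∑ k ∈ Finset.range n,
      lam k * (1 / avgConst β (γ k) (U k) - lam k)) atTop atTop) : ¬Summable lam := by
  have hterm (k : ℕ) : 0 ≤ lam k * (1 / avgConst β (γ k) (U k) - lam k) :=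
    mul_nonneg (hI.lam_nonneg k) (sub_nonneg.2 (hI.lam_le k))
  refine fun hlam => (not_summable_iff_tendsto_nat_atTop_of_nonneg hterm).2 hdiv
    ((hlam.mul_right 2).of_nonneg_of_le hterm fun k => ?_)
  have hβ := hI.beta_pos
  have hγ := hI.gamma_pos k
  refine mul_le_mul_of_nonneg_left ?_ (hI.lam_nonneg k)
  rw [one_div_avgConst hβ, sub_sub]
  exact sub_le_self _ (add_nonneg (by positivity) (hI.lam_nonneg k))

theorem summable_stepError (hI : IsForwardBackwardIteration A B α β η U γ lam a b x) :
    Summable (stepError α β lam a b) := by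
  refine (((hI.summable_b.mul_left (2 * β)).add hI.summable_a).div_const √α).congr fun k => ?_
  rw [stepError]
  ring

theorem stepError_nonneg (hI : IsForwardBackwardIteration A B α β η U γ lam a b x) (k : ℕ) :
    0 ≤ stepError α β lam a b k := by
  have hβ := hI.beta_pos
  exact mul_nonneg (hI.lam_nonneg k) (by positivity)

theorem isPositive_inverse (hI : IsForwardBackwardIteration A B α β η U γ lam a b x) (k : ℕ) :
    (U k).inverse.IsPositive :=
  isPositive_inverse_of_mem_strongPos hI.alpha_pos (hI.mem_strongPos k)

theorem inner_sub_nonneg (hI : IsForwardBackwardIteration A B α β η U γ lam a b x)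
    (hxs : xs ∈ zer (addSingle A B)) (k : ℕ) :
    0 ≤ ⟪x k - xs - fbResidual A B (γ k) (U k) (x k),
      (U k).inverse (fbResidual A B (γ k) (U k) (x k)) - γ k • (B (x k) - B xs)⟫_ℝ :=
  inner_sub_fbResidual_nonneg hI.maximal hI.alpha_pos (hI.mem_strongPos k) (hI.gamma_pos k) _ hxs

theorem metricNorm_succ_sub_le (hI : IsForwardBackwardIteration A B α β η U γ lam a b x)
    (k : ℕ) : metricNorm (U k).inverse
      (x (k + 1) - (x k - lam k • fbResidual A B (γ k) (U k) (x k))) ≤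
        stepError α β lam a b k := by
  have herr : x (k + 1) - (x k - lam k • fbResidual A B (γ k) (U k) (x k)) = lam k •
      (resolvent (scaledOp (γ k) (U k) A) (x k - γ k • U k (B (x k) + b k)) -
        fbOp A B (γ k) (U k) (x k) + a k) := by
    rw [hI.step k, fbResidual]
    module
  rw [herr, metricNorm_smul, abs_of_nonneg (hI.lam_nonneg k), stepError]
  exact mul_le_mul_of_nonneg_left (metricNorm_resolvent_sub_fbOp_add_le hI.maximal hI.alpha_pos
    (hI.mem_strongPos k) (hI.gamma_pos k) (hI.gamma_le k) _ _ _) (hI.lam_nonneg k)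

theorem sq_metricNorm_succ_le (hI : IsForwardBackwardIteration A B α β η U γ lam a b x)
    (xs : H) (k : ℕ) :
    metricNorm (U (k + 1)).inverse (x (k + 1) - xs) ^ 2 ≤ (1 + η k) *
      (metricNorm (U k).inverse (x k - xs - lam k • fbResidual A B (γ k) (U k) (x k)) +
        stepError α β lam a b k) ^ 2 := by
  have hη : 0 < 1 + η k := by linarith [hI.eta_nonneg k]
  rw [metricNorm_sq (hI.isPositive_inverse _)]
  refine (inner_inverse_le_mul hI.alpha_pos (hI.mem_strongPos k) hI.alpha_pos
    (hI.mem_strongPos (k + 1)) hη (hI.le_succ k) _).trans ?_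
  rw [← metricNorm_sq (hI.isPositive_inverse k)]
  gcongr
  · exact metricNorm_nonneg _ _
  rw [show x (k + 1) - xs = x k - xs - lam k • fbResidual A B (γ k) (U k) (x k) +
    (x (k + 1) - (x k - lam k • fbResidual A B (γ k) (U k) (x k))) by abel]
  exact (metricNorm_add_le (hI.isPositive_inverse k) _ _).trans
    (add_le_add le_rfl (hI.metricNorm_succ_sub_le k))

theorem tendsto_metricNorm_and_summable
    (hI : IsForwardBackwardIteration A B α β η U γ lam a b x) (hxs : xs ∈ zer (addSingle A B)) :
    (∃ l, Tendsto (fun k => metricNorm (U k).inverse (x k - xs)) atTop (𝓝 l)) ∧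
      Summable fun k => lam k * fbGap (γ k * ‖U k‖ / (2 * β)) (U k).inverse (x k - xs)
        (fbResidual A B (γ k) (U k) (x k)) := by
  have hβ := hI.beta_pos
  refine tendsto_and_summable_of_sq_le (fun k => metricNorm_nonneg _ _) (fun k => ?_)
    hI.eta_nonneg hI.eta_summable hI.stepError_nonneg hI.summable_stepError
    (fun k => sq_metricNorm_sub_smul_le (hI.isPositive_inverse k) (hI.lam_nonneg k)
      (hI.lam_le_two_sub k) _ _) (hI.sq_metricNorm_succ_le xs)
  have hγ := hI.gamma_pos k
  refine mul_nonneg (hI.lam_nonneg k) (fbGap_nonneg hI.alpha_pos (hI.mem_strongPos k) hγ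
    (by positivity) ?_ (hI.cocoercive _ _) (hI.inner_sub_nonneg hxs k))
  rw [mul_div_cancel₀ _ (by positivity)]

theorem exists_metricNorm_sub_le (hI : IsForwardBackwardIteration A B α β η U γ lam a b x)
    (hxs : xs ∈ zer (addSingle A B)) :
    ∃ R, ∀ k, metricNorm (U k).inverse (x k - xs) ≤ R := by
  obtain ⟨⟨l, hl⟩, -⟩ := hI.tendsto_metricNorm_and_summable hxs
  obtain ⟨R, hR⟩ := hl.bddAbove_range
  exact ⟨R, fun k => hR ⟨k, rfl⟩⟩

theorem exists_norm_sub_le (hI : IsForwardBackwardIteration A B α β η U γ lam a b x)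
    (hUm : ∀ k, ‖U k‖ ≤ m) (hxs : xs ∈ zer (addSingle A B)) : ∃ R, ∀ k, ‖x k - xs‖ ≤ R := by
  obtain ⟨R, hR⟩ := hI.exists_metricNorm_sub_le hxs
  exact ⟨√m * R, fun k => (norm_le_metricNorm_inverse hI.alpha_pos (hI.mem_strongPos k) (hUm k)
    _).trans (mul_le_mul_of_nonneg_left (hR k) (Real.sqrt_nonneg m))⟩

theorem norm_succ_sub_le (hI : IsForwardBackwardIteration A B α β η U γ lam a b x)
    (hUm : ∀ k, ‖U k‖ ≤ m) (k : ℕ) :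
    ‖x (k + 1) - x k‖ ≤
      lam k * ‖fbResidual A B (γ k) (U k) (x k)‖ + √m * stepError α β lam a b k := by
  set s := lam k • fbResidual A B (γ k) (U k) (x k) with hs
  have herr : ‖x (k + 1) - (x k - s)‖ ≤ √m * stepError α β lam a b k :=
    (norm_le_metricNorm_inverse hI.alpha_pos (hI.mem_strongPos k) (hUm k) _).trans
      (mul_le_mul_of_nonneg_left (hI.metricNorm_succ_sub_le k) (Real.sqrt_nonneg m))
  have hnorm : ‖s‖ = lam k * ‖fbResidual A B (γ k) (U k) (x k)‖ := by
    rw [hs, norm_smul, Real.norm_of_nonneg (hI.lam_nonneg k)]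
  rw [← hnorm, add_comm ‖s‖, show x (k + 1) - x k = x (k + 1) - (x k - s) - s by abel]
  exact norm_sub_le_of_le herr le_rfl

theorem summable_lam_mul_norm_pow_four
    (hI : IsForwardBackwardIteration A B α β η U γ lam a b x)
    (hΩ : (zer (addSingle A B)).Nonempty) (hγlow : 0 < γlow) (hγ : ∀ k, γlow ≤ γ k) {ε : ℝ}
    (hε : 0 < ε) (hγU : ∀ k, γ k * ‖U k‖ ≤ 2 * β - ε) :
    Summable fun k => lam k * ‖fbResidual A B (γ k) (U k) (x k)‖ ^ 4 := by
  obtain ⟨xs, hxs⟩ := hΩ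
  obtain ⟨R, hR⟩ := hI.exists_metricNorm_sub_le hxs
  have hgap := (hI.tendsto_metricNorm_and_summable hxs).2
  have hβ := hI.beta_pos
  set C := 12 * β ^ 2 / (γlow * ε) * R
  refine (hgap.mul_left (C ^ 2)).of_nonneg_of_le
    (fun k => mul_nonneg (hI.lam_nonneg k) (by positivity)) fun k => ?_
  set v := fbResidual A B (γ k) (U k) (x k)
  set G := fbGap (γ k * ‖U k‖ / (2 * β)) (U k).inverse (x k - xs) v
  have hγk := hI.gamma_pos k
  have hG : 0 ≤ G := fbGap_nonneg hI.alpha_pos (hI.mem_strongPos k) hγk (by positivity)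
    (by rw [mul_div_cancel₀ _ (by positivity)]) (hI.cocoercive _ _) (hI.inner_sub_nonneg hxs k)
  have hsq : ‖v‖ ^ 2 ≤ C * √G :=
    (sq_norm_le_mul_sqrt_fbGap hI.alpha_pos hβ (hI.mem_strongPos k) hγlow (hγ k) hε (hγU k)
      (hI.cocoercive _ _) (hI.inner_sub_nonneg hxs k)).trans
      (mul_le_mul_of_nonneg_right (mul_le_mul_of_nonneg_left (hR k) (by positivity))
        (Real.sqrt_nonneg G))
  calc lam k * ‖v‖ ^ 4 = lam k * (‖v‖ ^ 2) ^ 2 := by ring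
    _ ≤ lam k * (C * √G) ^ 2 := by
      gcongr
      exact hI.lam_nonneg k
    _ = C ^ 2 * (lam k * G) := by
      rw [mul_pow, Real.sq_sqrt hG]
      ring

theorem exists_norm_fbResidual_succ_sub_le
    (hI : IsForwardBackwardIteration A B α β η U γ lam a b x)
    (hΩ : (zer (addSingle A B)).Nonempty) (hγlow : 0 < γlow) (hγ : ∀ k, γlow ≤ γ k)
    (hUm : ∀ k, ‖U k‖ ≤ m) (hΔγ : Summable fun k => |γ (k + 1) - γ k|) :
    ∃ C s, 0 ≤ C ∧ Summable s ∧ (∀ k, 0 ≤ s k) ∧ ∀ k,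
      ‖fbResidual A B (γ (k + 1)) (U (k + 1)) (x (k + 1)) - fbResidual A B (γ k) (U k) (x k)‖ ≤
        C * (lam k * ‖fbResidual A B (γ k) (U k) (x k)‖) + s k +
          m * ‖(U k).inverse (fbResidual A B (γ k) (U k) (x k)) -
            (U (k + 1)).inverse (fbResidual A B (γ k) (U k) (x k))‖ := by
  obtain ⟨xs, hxs⟩ := hΩ
  obtain ⟨R, hR⟩ := hI.exists_norm_sub_le hUm hxs
  have hα := hI.alpha_pos
  have hm : 0 ≤ m := (norm_nonneg _).trans (hUm 0)
  have hR₀ : 0 ≤ R := (norm_nonneg _).trans (hR 0)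
  set L := 1 + √m / √α
  set C := L * (1 + 2 * m / α)
  refine ⟨C, fun k => C * (√m * stepError α β lam a b k) +
    m * (L * R) / (γlow * α) * |γ (k + 1) - γ k|, by positivity,
    ((hI.summable_stepError.mul_left _).mul_left _).add (hΔγ.mul_left _), fun k => ?_, fun k => ?_⟩
  · have hstep := hI.stepError_nonneg k
    positivity
  set v := fbResidual A B (γ k) (U k) (x k)
  set w := fbResidual A B (γ k) (U k) (x (k + 1))
  have hU := hI.mem_strongPos k
  have hw : ‖w‖ ≤ L * R := by
    have hlip := norm_fbResidual_sub_le hI.maximal hI.cocoercive hα hU (hI.gamma_pos k)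
      (hI.gamma_le k) (hUm k) (x (k + 1)) xs
    rw [fbResidual_eq_zero hI.maximal hα hU (hI.gamma_pos k) hxs, sub_zero] at hlip
    exact hlip.trans (by gcongr; exact hR _)
  refine (norm_fbResidual_sub_fbResidual_le hI.maximal hI.cocoercive hα hU (hI.gamma_pos k)
    (hI.gamma_le k) (hI.mem_strongPos (k + 1)) (hI.gamma_pos (k + 1)) (hUm k) (hUm (k + 1))
    rfl rfl rfl).trans ?_
  have hx : C * ‖x (k + 1) - x k‖ ≤ C * (lam k * ‖v‖ + √m * stepError α β lam a b k) := by
    gcongr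
    exact hI.norm_succ_sub_le hUm k
  have hγ_change : m * (|γ (k + 1) - γ k| / γ k * (‖w‖ / α)) ≤
      m * (L * R) / (γlow * α) * |γ (k + 1) - γ k| := calc
    _ ≤ m * (|γ (k + 1) - γ k| / γlow * (L * R / α)) := by
      gcongr
      exact hγ k
    _ = _ := by field_simp
  linarith

theorem tendsto_fbResidual (hI : IsForwardBackwardIteration A B α β η U γ lam a b x)
    (hΩ : (zer (addSingle A B)).Nonempty) (hγlow : 0 < γlow) (hγ : ∀ k, γlow ≤ γ k) {ε : ℝ}
    (hε : 0 < ε) (hγU : ∀ k, γ k * ‖U k‖ ≤ 2 * β - ε) (hlam : ¬Summable lam)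
    (hΔγ : Summable fun k => |γ (k + 1) - γ k|)
    (hΔU : ∀ z, Summable fun k => ‖(U k).inverse z - (U (k + 1)).inverse z‖) :
    Tendsto (fun k => fbResidual A B (γ k) (U k) (x k)) atTop (𝓝 0) := by
  have hβ := hI.beta_pos
  obtain ⟨C, s, hC, hs, hs₀, hincr⟩ :=
    hI.exists_norm_fbResidual_succ_sub_le hΩ hγlow hγ (hI.opNorm_le hγlow hγ) hΔγ
  exact tendsto_zero_iff_norm_tendsto_zero.2 <|
    tendsto_zero_of_eventually_le_two_mul_add_sum (p := 3) (fun k => norm_nonneg _)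
      hI.lam_nonneg hI.lam_le_two hlam
      (hI.summable_lam_mul_norm_pow_four hΩ hγlow hγ hε hγU) hs hs₀ hC
      (eventually_norm_le_two_mul_add_sum (D := fun k => (U k).inverse - (U (k + 1)).inverse)
        hΔU (by positivity) hincr)

theorem tendsto_forward (hI : IsForwardBackwardIteration A B α β η U γ lam a b x)
    (hγlow : 0 < γlow) (hγ : ∀ k, γlow ≤ γ k)
    (hres : Tendsto (fun k => fbResidual A B (γ k) (U k) (x k)) atTop (𝓝 0))
    (hxs : xs ∈ zer (addSingle A B)) : Tendsto (fun k => B (x k)) atTop (𝓝 (B xs)) := by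
  obtain ⟨R, hR⟩ := hI.exists_norm_sub_le (hI.opNorm_le hγlow hγ) hxs
  have hβ := hI.beta_pos
  have hα := hI.alpha_pos
  have hle (k : ℕ) : β ^ 2 * ‖B (x k) - B xs‖ ^ 2 ≤
      (1 + β / (α * γlow)) * R * ‖fbResidual A B (γ k) (U k) (x k)‖ :=
    (sq_norm_le_mul_norm_mul_norm hα hβ (hI.mem_strongPos k) (hI.gamma_pos k)
      (hI.cocoercive _ _) (hI.cocoercive.mul_norm_sub_le _ _) (hI.inner_sub_nonneg hxs k)).trans
      (by gcongr; exacts [hγ k, hR k])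
  have hsq : Tendsto (fun k => (β * ‖B (x k) - B xs‖) ^ 2) atTop (𝓝 0) :=
    squeeze_zero (fun k => sq_nonneg _) (fun k => (mul_pow _ _ 2).trans_le (hle k))
      (by simpa using hres.norm.const_mul ((1 + β / (α * γlow)) * R))
  have hnorm : Tendsto (fun k => β * ‖B (x k) - B xs‖) atTop (𝓝 0) := by
    simpa only [Real.sqrt_zero, Real.sqrt_sq (mul_nonneg hβ.le (norm_nonneg _))] using hsq.sqrt
  refine tendsto_iff_norm_sub_tendsto_zero.2 ?_
  simpa [hβ.ne'] using hnorm.const_mul β⁻¹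

theorem tendsto_smul_inverse_fbResidual
    (hI : IsForwardBackwardIteration A B α β η U γ lam a b x) (hγlow : 0 < γlow)
    (hγ : ∀ k, γlow ≤ γ k)
    (hres : Tendsto (fun k => fbResidual A B (γ k) (U k) (x k)) atTop (𝓝 0)) :
    Tendsto (fun k => (γ k)⁻¹ • (U k).inverse (fbResidual A B (γ k) (U k) (x k))) atTop (𝓝 0) := by
  refine squeeze_zero_norm (fun k => ?_)
    (by simpa using (hres.norm.div_const α).const_mul γlow⁻¹)
  rw [norm_smul, norm_inv, Real.norm_of_nonneg (hI.gamma_pos k).le]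
  gcongr
  · exact hγ k
  · rw [le_div_iff₀' hI.alpha_pos]
    exact mul_norm_inverse_le_of_mem_strongPos hI.alpha_pos (hI.mem_strongPos k) _

theorem mem_zer_of_weaklyTendsto (hI : IsForwardBackwardIteration A B α β η U γ lam a b x)
    (hγlow : 0 < γlow) (hγ : ∀ k, γlow ≤ γ k)
    (hres : Tendsto (fun k => fbResidual A B (γ k) (U k) (x k)) atTop (𝓝 0))
    (hxs : xs ∈ zer (addSingle A B)) (hR : ∀ k, ‖x k‖ ≤ R) {F : Filter ℕ} [F.NeBot]
    (hF : F ≤ atTop) {z : H} (hz : WeaklyTendsto x F z) : z ∈ zer (addSingle A B) := by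
  have hforward := hI.tendsto_forward hγlow hγ hres hxs
  obtain ⟨V, hV⟩ := hres.norm.bddAbove_range
  have hbackward := (hI.tendsto_smul_inverse_fbResidual hγlow hγ hres).sub hforward
  have hfbOp : WeaklyTendsto (fun k => x k - fbResidual A B (γ k) (U k) (x k)) F z := by
    simpa using hz.sub_of_tendsto (hres.mono_left hF)
  rw [mem_zer_addSingle_iff,
    hI.cocoercive.eq_of_weaklyTendsto hI.beta_pos hz hR (hforward.mono_left hF), ← zero_sub]
  refine hI.maximal.mem_of_weaklyTendsto hfbOp
    (fun k => norm_sub_le_of_le (hR k) (hV ⟨k, rfl⟩)) (hbackward.mono_left hF) fun k => ?_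
  rw [sub_fbResidual]
  exact smul_inverse_fbResidual_sub_mem hI.maximal hI.alpha_pos (hI.mem_strongPos k)
    (hI.gamma_pos k) _

theorem exists_weaklyTendsto (hI : IsForwardBackwardIteration A B α β η U γ lam a b x)
    (hΩ : (zer (addSingle A B)).Nonempty) (hγlow : 0 < γlow) (hγ : ∀ k, γlow ≤ γ k)
    (hres : Tendsto (fun k => fbResidual A B (γ k) (U k) (x k)) atTop (𝓝 0))
    (hΔU : ∀ z, Summable fun k => ‖(U k).inverse z - (U (k + 1)).inverse z‖) :
    ∃ z ∈ zer (addSingle A B), WeaklyTendsto x atTop z := by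
  obtain ⟨xs, hxs⟩ := hΩ
  have hβ := hI.beta_pos
  have hUm := hI.opNorm_le hγlow hγ
  have hm : 0 < 2 * β / γlow := by positivity
  obtain ⟨R, hR⟩ := hI.exists_norm_sub_le hUm hxs
  have hbound (k : ℕ) : ‖x k‖ ≤ R + ‖xs‖ := by
    linarith [hR k, norm_sub_norm_le (x k) xs]
  refine exists_weaklyTendsto_of_tendsto_metricNorm hbound hI.isPositive_inverse (inv_pos.2 hm)
    (fun k y => ?_) (fun y => ?_) (fun y hy => (hI.tendsto_metricNorm_and_summable hy).1)
    fun G hG y hy => hI.mem_zer_of_weaklyTendsto hγlow hγ hres hxs hbound hG hy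
  · rw [inv_mul_le_iff₀ hm]
    exact sq_norm_le_mul_inner_inverse hI.alpha_pos (hI.mem_strongPos k) (hUm k) y
  · exact cauchySeq_tendsto_of_complete
      (cauchySeq_of_summable_dist (by simpa only [dist_eq_norm] using hΔU y))

end IsForwardBackwardIteration

end Iteration

end VMFB

theorem theorem3p2_general {H : Type*} [NormedAddCommGroup H] [InnerProductSpace ℝ H]
    [CompleteSpace H] {A : H → Set H} {B : H → H} {α β : ℝ} {η : ℕ → ℝ} {U : ℕ → H →L[ℝ] H}
    {γ lam : ℕ → ℝ} {a b x : ℕ → H}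
    (hI : VMFB.IsForwardBackwardIteration A B α β η U γ lam a b x)
    (hΩ : (VMFB.zer (VMFB.addSingle A B)).Nonempty) :
    (∀ xs ∈ VMFB.zer (VMFB.addSingle A B), ∃ l : ℝ,
      Tendsto (fun k => VMFB.metricNorm (U k).inverse (x k - xs)) atTop (𝓝 l)) ∧
    ((¬Summable lam) →
      (∃ γlow ε : ℝ, 0 < γlow ∧ 0 < ε ∧ ∀ k, γlow ≤ γ k ∧ γ k * ‖U k‖ ≤ 2 * β - ε) →
      (Summable fun k => |γ (k + 1) - γ k|) →
      (∀ z : H, Summable fun k => ‖(U k).inverse z - (U (k + 1)).inverse z‖) →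
      Tendsto (fun k => ‖x k - VMFB.fbOp A B (γ k) (U k) (x k)‖) atTop (𝓝 0) ∧
      (∃ xbar ∈ VMFB.zer (VMFB.addSingle A B),
        Tendsto (fun k => toWeakSpace ℝ H (x k)) atTop (𝓝 (toWeakSpace ℝ H xbar))) ∧
      ∀ xs ∈ VMFB.zer (VMFB.addSingle A B), Tendsto (fun k => B (x k)) atTop (𝓝 (B xs))) := by
  refine ⟨fun xs hxs => (hI.tendsto_metricNorm_and_summable hxs).1, ?_⟩
  rintro hlam ⟨γlow, ε, hγlow, hε, hγ⟩ hΔγ hΔU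
  have hγ_ge (k : ℕ) : γlow ≤ γ k := (hγ k).1
  have hres := hI.tendsto_fbResidual hΩ hγlow hγ_ge hε (fun k => (hγ k).2) hlam hΔγ hΔU
  obtain ⟨xbar, hxbar, hweak⟩ := hI.exists_weaklyTendsto hΩ hγlow hγ_ge hres hΔU
  exact ⟨tendsto_zero_iff_norm_tendsto_zero.1 hres,
    ⟨xbar, hxbar, VMFB.tendsto_toWeakSpace_iff.2 hweak⟩,
    fun xs hxs => hI.tendsto_forward hγlow hγ_ge hres hxs⟩

theorem theorem3p2 {H : Type*} [NormedAddCommGroup H] [InnerProductSpace ℝ H] [CompleteSpace H]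
    (A : H → Set H) (hA : VMFB.IsMaximalMonotone A)
    (B : H → H) (β : ℝ) (hβ : 0 < β) (hB : VMFB.IsCocoercive β B)
    (hΩ : (VMFB.zer (VMFB.addSingle A B)).Nonempty)
    (α : ℝ) (hα : 0 < α)
    (η : ℕ → ℝ) (hη0 : ∀ k, 0 ≤ η k) (hη : Summable η)
    (U : ℕ → H →L[ℝ] H) (hU : ∀ k, U k ∈ VMFB.strongPos α)
    (μ : ℝ) (hμ : IsLUB (Set.range fun k => ‖U k‖) μ)
    (hUmono : ∀ k, U k ≤ (1 + η k) • U (k + 1))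
    (γ : ℕ → ℝ) (hγ0 : ∀ k, 0 < γ k) (hγ : ∀ k, γ k * ‖U k‖ < 2 * β)
    (lam : ℕ → ℝ) (hlam0 : ∀ k, 0 < lam k)
    (hlam : ∀ k, lam k < 1 / VMFB.avgConst β (γ k) (U k))
    (a b : ℕ → H)
    (ha : Summable fun k => lam k * ‖a k‖) (hb : Summable fun k => lam k * ‖b k‖)
    (x y : ℕ → H)
    (hy : ∀ k, y k = x k - γ k • U k (B (x k) + b k))
    (hx : ∀ k, x (k + 1) = x k +
      lam k • (VMFB.resolvent (VMFB.scaledOp (γ k) (U k) A) (y k) + a k - x k)) :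
    (∀ xs ∈ VMFB.zer (VMFB.addSingle A B), ∃ l : ℝ,
      Tendsto (fun k => VMFB.metricNorm (U k).inverse (x k - xs)) atTop (𝓝 l)) ∧
    ((Tendsto (fun n => ∑ k ∈ Finset.range n,
        lam k * (1 / VMFB.avgConst β (γ k) (U k) - lam k)) atTop atTop) →
      (∃ γlow ε : ℝ, 0 < γlow ∧ 0 < ε ∧ ε < 2 * β - μ * γlow ∧
        ∀ k, γlow ≤ γ k ∧ γ k * μ ≤ 2 * β - ε) →
      (Summable fun k => |γ (k + 1) - γ k|) →
      (Summable fun k => |γ (k + 1) * ‖U (k + 1)‖ - γ k * ‖U k‖|) →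
      (∀ z : H, Summable fun k => ‖(U k).inverse z - (U (k + 1)).inverse z‖) →
      Tendsto (fun k => ‖x k - VMFB.fbOp A B (γ k) (U k) (x k)‖) atTop (𝓝 0) ∧
      (∃ xbar ∈ VMFB.zer (VMFB.addSingle A B),
        Tendsto (fun k => toWeakSpace ℝ H (x k)) atTop (𝓝 (toWeakSpace ℝ H xbar))) ∧
      ((∃ lamlow : ℝ, 0 < lamlow ∧ ∀ k, lamlow ≤ lam k) →
        ∀ xs ∈ VMFB.zer (VMFB.addSingle A B),
          Tendsto (fun k => B (x k)) atTop (𝓝 (B xs)))) := by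
  have hI : VMFB.IsForwardBackwardIteration A B α β η U γ lam a b x :=
    ⟨hA, hβ, hB, hα, hη0, hη, hU, hUmono, hγ0, fun k => (hγ k).le, fun k => (hlam0 k).le,
      fun k => (hlam k).le, ha, hb, fun k => by rw [hx k, hy k]⟩
  refine ⟨(theorem3p2_general hI hΩ).1, fun hdiv ⟨γlow, ε, hγlow, hε, _, hγε⟩ hΔγ _ hΔU => ?_⟩
  have hstep (k : ℕ) : γlow ≤ γ k ∧ γ k * ‖U k‖ ≤ 2 * β - ε := ⟨(hγε k).1,
    (mul_le_mul_of_nonneg_left (hμ.1 ⟨k, rfl⟩) (hγ0 k).le).trans (hγε k).2⟩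
  obtain ⟨hres, hweak, hforward⟩ := (theorem3p2_general hI hΩ).2 (hI.not_summable_lam hdiv)
    ⟨γlow, ε, hγlow, hε, hstep⟩ hΔγ hΔU
  exact ⟨hres, hweak, fun _ => hforward⟩
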